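/- **Theorem 6.** Fix $K$, a vector $\beta_0=(\beta_{1,0},\dots,\beta_{K,0})^t\in\mathbb R^K$ and $\sigma_0^2>0$. For each $n$ let $\mathbf X=\mathbf X_n$ be a real $n\times K$ design matrix with rows $\mathbf x_i^t=(x_{i,1},\dots,x_{i,K})$ (depending on $n$), and let $Y_i=\mathbf x_i^t\beta_0+\varepsilon_i$, $i=1,\dots,n$, where the errors $\varepsilon_1,\dots,\varepsilon_n$ (which may also depend on $n$) are independent with $\mathbb E(\varepsilon_i)=0$, $\mathbb E(\varepsilon_i^2)=\sigma_0^2$ and $\mathbb E(\varepsilon_i^4)\le M$ for some $M<\infty$ not depending on $i,n$. Assume that the design is orthogonal, $n^{-1}\mathbf X^t\mathbf X=\mathbf I$ for every $n>K$, and that (D2) $\max_{1\le i\le n}\|\mathbf x_i\|/\sqrt n\to0$, where $\|\cdot\|$ is the $\ell_2$-norm. For $n>K$ let $\hat\beta_n^\circ=(\mathbf X^t\mathbf X)^{-1}\mathbf X^t\mathbf Y$, $\hat\sigma_n^2=\|\mathbf Y-\mathbf X\hat\beta_n^\circ\|^2/(n-K)$, $Y_i^*=\hat\sigma_n^{-1}n^{1/2}Y_i$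 and $\xi_{k,n}=\hat\sigma_n^{-1}n^{-1/2}\sum_{i=1}^n x_{i,k}Y_i$. Consider the Bayesian model in which, given $(\beta,\sigma^2)$, the $Y_i^*$ are independent with laws $N(\mathbf x_i^t\beta,\sigma^2\lambda_n)$, $\beta$ given $\gamma$ is $N(\mathbf 0,\mathrm{diag}(\gamma_1,\dots,\gamma_K))$, $\gamma\sim\pi$ and $\sigma^2\sim\mu$ independently, where $\pi$ is a probability measure on $\mathbb R^K$ with $\pi\{\gamma_k>0\}=1$ for all $k$, $\mu\{\sigma^2=1\}=1$ and $\lambda_n=n$. Posterior laws given $\mathbf Y^*$ are those given by Bayes' formula; $\pi_n(\cdot\mid\mathbf Y^*)$ is the posterior law of $\gamma$. (a) If the support of $\pi$ contains $[\eta_0,\infty)^K$ for some finite $\eta_0\ge0$, then for every $\delta>0$ and every $k$ with $\beta_{k,0}\ne0$, $$\pi_n\Big(\Big\{\gamma:\frac{\gamma_k}{1+\gamma_k}>1-\delta\Big\}\,\Big|\,\mathbf Y^*\Big)\to1\quad\text{in probability as } n\to\infty.$$ (b) Let $v_0,a_1,a_2>0$, and let $\pi$ be the continuous bimodal prior: $w\sim\mathrm{Uniform}[0,1]$,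 and given $w$, $\gamma_k=\mathcal I_k\tau_k^2$, $k=1,\dots,K$, where all $\mathcal I_k$, $\tau_k^{2}$ are independent, $\mathcal I_k\sim(1-w)\delta_{v_0}+w\delta_1$, and $\tau_k^{-2}$ has the gamma density $g(u)=\frac{a_2^{a_1}}{\Gamma(a_1)}u^{a_1-1}e^{-a_2u}$, $u>0$. Then for every $n>K$, every realization of the data (with $\hat\sigma_n>0$), every $w\in[0,1]$ and every $k$, the posterior law of $\gamma_k$ given $w$, that is, under the prior law of $\gamma$ given $w$, has a density on $(0,\infty)$ that satisfies $$f_k^*(u\mid w)\propto\exp\Big(\frac{u}{2(1+u)}\xi_{k,n}^2\Big)(1+u)^{-1/2}\big((1-w)g_0(u)+wg_1(u)\big),\qquad u>0,$$ where $g_0(u)=v_0u^{-2}g(v_0u^{-1})$, $g_1(u)=u^{-2}g(u^{-1})$, and the positive constant of proportionality does not depend on $u$. The posterior laws of $\gamma$ given $w$, $w\in[0,1]$, are a version of the conditional law of $\gamma$ given $w$ under the joint posterior law of $(w,\gamma)$ given $\mathbf Y^*$. Moreover, for every $k$ with $\beta_{k,0}=0$, $\xi_{k,n}$ converges in distribution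 to $N(0,1)$ as $n\to\infty$. -/

import Mathlib

open MeasureTheory ProbabilityTheory Filter Matrix
open scoped Topology ENNReal

namespace SpikeSlab

noncomputable section

/-! ### The linear regression model -/

/-- The ordinary least squares estimate `(XᵀX)⁻¹ Xᵀ Y`. -/
def olsEstimate {n K : ℕ} (X : Matrix (Fin n) (Fin K) ℝ) (Y : Fin n → ℝ) : Fin K → ℝ :=
  (Xᵀ * X)⁻¹ *ᵥ (Xᵀ *ᵥ Y)

/-- `σ̂ₙ`, the square root of `σ̂ₙ² = ‖Y - X β̂‖² / (n - K)` (meaningful for `K < n`). -/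
def sigmaHat {n K : ℕ} (X : Matrix (Fin n) (Fin K) ℝ) (Y : Fin n → ℝ) : ℝ :=
  √((∑ i, (Y i - (X *ᵥ olsEstimate X Y) i) ^ 2) / ((n : ℝ) - (K : ℝ)))

/-- The rescaled responses `Yᵢ* = σ̂ₙ⁻¹ n^{1/2} Yᵢ`. -/
def rescaled {n K : ℕ} (X : Matrix (Fin n) (Fin K) ℝ) (Y : Fin n → ℝ) : Fin n → ℝ :=
  fun i => (sigmaHat X Y)⁻¹ * √(n : ℝ) * Y i

/-- The statistic `ξ_{k,n} = σ̂ₙ⁻¹ n^{-1/2} ∑ᵢ x_{i,k} Yᵢ`. -/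
def xi {n K : ℕ} (X : Matrix (Fin n) (Fin K) ℝ) (Y : Fin n → ℝ) (k : Fin K) : ℝ :=
  (sigmaHat X Y)⁻¹ * (√(n : ℝ))⁻¹ * ∑ i, X i k * Y i

/-- Negligibility of single covariates: `max_{1 ≤ i ≤ n} ‖xᵢ‖ / √n → 0` (Euclidean norm of the
rows of the design matrices). -/
def NegligibleCovariates {K : ℕ} (X : (n : ℕ) → Matrix (Fin n) (Fin K) ℝ) : Prop :=
  Tendsto (fun n : ℕ => (⨆ i : Fin n, ‖WithLp.toLp 2 (X n i)‖) / √(n : ℝ)) atTop (𝓝 0)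

/-- Orthogonal design: `Σₙ = XᵀX / n = I` for every sample size `n > K`. -/
def OrthogonalDesign {K : ℕ} (X : (n : ℕ) → Matrix (Fin n) (Fin K) ℝ) : Prop :=
  ∀ n : ℕ, K < n → (n : ℝ)⁻¹ • ((X n)ᵀ * X n) = 1

/-- The responses `Y = X β₀ + ε`. -/
def response {n K : ℕ} (X : Matrix (Fin n) (Fin K) ℝ) (β₀ : Fin K → ℝ) (ε : Fin n → ℝ) :
    Fin n → ℝ :=
  fun i => (X *ᵥ β₀) i + ε i

/-! ### The Bayesian hierarchy -/

/-- The law `N(0, Γ)` of `β` given `γ`, where `Γ = diag(γ₁, …, γ_K)` and all `γₖ` are positive. -/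
def betaGivenGamma {K : ℕ} (γ : Fin K → ℝ) : Measure (Fin K → ℝ) :=
  Measure.pi fun k => gaussianReal 0 (γ k).toNNReal

/-- The density at `y` of the responses given `β` and `σ² = s`, when they are independent with
laws `N(xᵢᵗ β, s * lam)`. -/
def dataDensity {n K : ℕ} (X : Matrix (Fin n) (Fin K) ℝ) (lam : ℝ) (y : Fin n → ℝ) (s : ℝ)
    (β : Fin K → ℝ) : ℝ≥0∞ :=
  ∏ i, gaussianPDF ((X *ᵥ β) i) (s * lam).toNNReal (y i)

/-- The density at `y` of the responses given `γ`: the parameters `σ² ∼ μ` and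
`β ∼ N(0, Γ)` are integrated out. -/
def likelihood {n K : ℕ} (X : Matrix (Fin n) (Fin K) ℝ) (lam : ℝ) (μ : Measure ℝ)
    (y : Fin n → ℝ) (γ : Fin K → ℝ) : ℝ≥0∞ :=
  ∫⁻ s, ∫⁻ β, dataDensity X lam y s β ∂(betaGivenGamma γ) ∂μ

/-- Bayes' formula: the posterior law of a parameter with prior `ρ`, when the observed data have
density `L θ` given the parameter value `θ`. -/
def bayes {Θ : Type*} [MeasurableSpace Θ] (ρ : Measure Θ) (L : Θ → ℝ≥0∞) : Measure Θ :=
  (∫⁻ θ, L θ ∂ρ)⁻¹ • ρ.withDensity L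

/-! ### The continuous bimodal prior -/

/-- The law `(1 - w) δ_{v₀} + w δ_1` of an indicator given `w`. -/
def indicatorLaw (v₀ : ℝ) (w : unitInterval) : Measure ℝ :=
  ENNReal.ofReal (1 - (w : ℝ)) • Measure.dirac v₀ + ENNReal.ofReal (w : ℝ) • Measure.dirac 1

/-- The law of one hypervariance `γₖ = Iₖ τₖ²` given `w`: the indicator `Iₖ` and `τₖ⁻²` are
independent, and `τₖ⁻²` has the gamma law with density proportional to `t^(a₁-1) exp (-a₂ t)`. -/
def hypervarianceLaw (v₀ a₁ a₂ : ℝ) (w : unitInterval) : Measure ℝ :=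
  ((indicatorLaw v₀ w).prod (gammaMeasure a₁ a₂)).map fun p => p.1 * p.2⁻¹

/-- The law of `γ = (γ₁, …, γ_K)` given `w`: the coordinates are independent. -/
def gammaGivenW (K : ℕ) (v₀ a₁ a₂ : ℝ) (w : unitInterval) : Measure (Fin K → ℝ) :=
  Measure.pi fun _ => hypervarianceLaw v₀ a₁ a₂ w

/-- The joint prior of `(w, γ)`, where `w` is uniform on `[0, 1]`. -/
def bimodalPrior (K : ℕ) (v₀ a₁ a₂ : ℝ) : Measure (unitInterval × (Fin K → ℝ)) :=
  (volume : Measure unitInterval).bind fun w => (gammaGivenW K v₀ a₁ a₂ w).map (Prod.mk w)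

/-- The gamma density `g(u) = a₂^{a₁} / Γ(a₁) * u^{a₁ - 1} exp(-a₂ u)`, used for `u > 0`. -/
def gDensity (a₁ a₂ u : ℝ) : ℝ :=
  a₂ ^ a₁ / Real.Gamma a₁ * u ^ (a₁ - 1) * Real.exp (-(a₂ * u))

/-- `g₀(u) = v₀ u⁻² g(v₀ u⁻¹)`. -/
def g₀ (v₀ a₁ a₂ u : ℝ) : ℝ := v₀ * (u ^ 2)⁻¹ * gDensity a₁ a₂ (v₀ * u⁻¹)

/-- `g₁(u) = u⁻² g(u⁻¹)`. -/
def g₁ (a₁ a₂ u : ℝ) : ℝ := (u ^ 2)⁻¹ * gDensity a₁ a₂ u⁻¹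

/-- `exp(u ξ² / (2 (1 + u))) (1 + u)^{-1/2} ((1 - w) g₀(u) + w g₁(u))`. -/
def posteriorShape (v₀ a₁ a₂ ξ w u : ℝ) : ℝ :=
  Real.exp (u / (2 * (1 + u)) * ξ ^ 2) * (√(1 + u))⁻¹ *
    ((1 - w) * g₀ v₀ a₁ a₂ u + w * g₁ a₁ a₂ u)

instance (v₀ : ℝ) (w : unitInterval) : IsProbabilityMeasure (indicatorLaw v₀ w) := by
  refine ⟨?_⟩
  have h0 := w.2.1
  have h1 := w.2.2
  simp only [indicatorLaw, Measure.add_apply, Measure.smul_apply, measure_univ, smul_eq_mul,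
    mul_one]
  rw [← ENNReal.ofReal_add (by linarith) h0]
  simp

lemma isProbabilityMeasure_hypervarianceLaw (v₀ : ℝ) {a₁ a₂ : ℝ} (h₁ : 0 < a₁) (h₂ : 0 < a₂)
    (w : unitInterval) : IsProbabilityMeasure (hypervarianceLaw v₀ a₁ a₂ w) := by
  have := isProbabilityMeasure_gammaMeasure h₁ h₂
  exact Measure.isProbabilityMeasure_map (by fun_prop)

lemma isProbabilityMeasure_gammaGivenW (K : ℕ) (v₀ : ℝ) {a₁ a₂ : ℝ} (h₁ : 0 < a₁) (h₂ : 0 < a₂)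
    (w : unitInterval) : IsProbabilityMeasure (gammaGivenW K v₀ a₁ a₂ w) := by
  have := isProbabilityMeasure_hypervarianceLaw v₀ h₁ h₂ w
  unfold gammaGivenW
  infer_instance

lemma measurable_hypervarianceLaw (v₀ : ℝ) {a₁ a₂ : ℝ} (h₁ : 0 < a₁) (h₂ : 0 < a₂) :
    Measurable (hypervarianceLaw v₀ a₁ a₂) := by
  have := isProbabilityMeasure_gammaMeasure h₁ h₂
  refine Measure.measurable_of_measurable_coe _ fun s hs => ?_
  have hm : Measurable fun p : ℝ × ℝ => p.1 * p.2⁻¹ := by fun_prop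
  have : ∀ w, hypervarianceLaw v₀ a₁ a₂ w s =
      ENNReal.ofReal (1 - (w : ℝ)) *
        ((Measure.dirac v₀).prod (gammaMeasure a₁ a₂)) ((fun p : ℝ × ℝ => p.1 * p.2⁻¹) ⁻¹' s) +
      ENNReal.ofReal (w : ℝ) *
        ((Measure.dirac 1).prod (gammaMeasure a₁ a₂)) ((fun p : ℝ × ℝ => p.1 * p.2⁻¹) ⁻¹' s) := by
    intro w
    rw [hypervarianceLaw, Measure.map_apply hm hs, indicatorLaw, Measure.add_prod,
      Measure.prod_smul_left, Measure.prod_smul_left]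
    simp
  simp_rw [this]
  fun_prop

/-- The family of conditional laws is measurable in `w`, so that `bimodalPrior` is the mixture. -/
lemma measurable_gammaGivenW (K : ℕ) (v₀ : ℝ) {a₁ a₂ : ℝ} (h₁ : 0 < a₁) (h₂ : 0 < a₂) :
    Measurable (gammaGivenW K v₀ a₁ a₂) := by
  have hp := isProbabilityMeasure_hypervarianceLaw v₀ h₁ h₂
  have := isProbabilityMeasure_gammaGivenW K v₀ h₁ h₂
  refine Measurable.measure_of_isPiSystem_of_isProbabilityMeasure
    (generateFrom_pi (α := fun _ : Fin K => ℝ)).symm isPiSystem_pi ?_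
  rintro _ ⟨s, hs, rfl⟩
  simp only [gammaGivenW, Measure.pi_pi]
  refine Finset.measurable_prod _ fun i _ => ?_
  have hi : MeasurableSet (s i) := hs i (Set.mem_univ i)
  exact (Measure.measurable_coe hi).comp
    (measurable_hypervarianceLaw v₀ h₁ h₂)

end

end SpikeSlab

/-!
# Rescaled spike and slab posteriors under an orthogonal design

Write `Zₖ = n^{-1/2} ∑ᵢ x_{i,k} εᵢ` for the standardized noise in the direction of the `k`-th
covariate. Since `XᵀX = n I`, everything depends on the data through `Z₁, …, Z_K` and `σ̂ₙ`: one has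
`ξₖ = σ̂ₙ⁻¹ (√n β₀ₖ + Zₖ)` (`xi_response`), and the residual sum of squares is `∑ εᵢ² - ∑ Zₖ²`
(`sum_sq_residual`). As `E Zₖ² = σ₀²` and the fourth moments are bounded, Markov's inequality gives
`σ̂ₙ² → σ₀²` and `n^{-1/2} Zₖ → 0` in probability.

*Null limit.* Negligible covariates and bounded fourth moments yield Lyapunov's condition for the
triangular array defining `Zₖ`. Lyapunov's theorem (`tendstoInDistribution_sum_of_lyapunov`, proved
by comparing characteristic functions factor by factor) gives `Zₖ / σ₀ → N(0, 1)`, and by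
Slutsky's theorem `σ₀` may be replaced by `σ̂ₙ`.

*Likelihood.* With `σ² = 1` and variance inflation `n`, the density of the rescaled responses given
`β` is a constant times `∏ₖ exp (βₖ ξₖ - βₖ² / 2)`, whence after integrating out `β ∼ N(0, Γ)` the
likelihood of `γ` is a constant times `∏ₖ (1 + γₖ)^{-1/2} exp (γₖ ξₖ² / (2 (1 + γₖ)))`
(`exists_likelihood_eq`).

*Nonzero coefficients.* The posterior mass of `{γₖ / (1 + γₖ) ≤ 1 - δ}` is bounded by a likelihood
ratio against the cube `(T, T + 1)^K`, which the prior charges as soon as `T ≥ η₀`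
(`bayes_productLikelihood_spike_le`). All `ξⱼ²` have order at most `n` and `ξₖ²` has exact order
`n`, so for a large fixed `T` the ratio is exponentially small in `n` (`spike_exponent_le`), even
though the prior need not have independent coordinates.

*Bimodal prior.* Given `w` the coordinates of `γ` are independent, so that the product likelihood
updates each of them separately (`map_eval_bayes_pi`), and the prior density of `γₖ` comes from the
change of variables `u = c / t` in the gamma law (`map_mul_inv_gammaMeasure`). Mixing over `w` is
the general disintegration `bayes_bind_prod`. If `σ̂ₙ = 0`, the convention `0⁻¹ = 0` makes the
rescaled responses and all `ξₖ` vanish, and the identities still hold.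
-/

namespace SpikeSlab

noncomputable section

/-! ### Lyapunov's central limit theorem -/

section Probability

lemma tendstoInMeasure_comp_of_continuousAt {Ω : Type*} [MeasurableSpace Ω] {P : Measure Ω}
    {f : ℕ → Ω → ℝ} {c : ℝ} {g : ℝ → ℝ} (hg : ContinuousAt g c)
    (hf : TendstoInMeasure P f atTop fun _ => c) :
    TendstoInMeasure P (fun n ω => g (f n ω)) atTop fun _ => g c := by
  rw [tendstoInMeasure_iff_dist] at hf ⊢
  intro r hr
  obtain ⟨δ, hδ, h⟩ := Metric.continuousAt_iff.1 hg r hr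
  refine tendsto_of_tendsto_of_tendsto_of_le_of_le tendsto_const_nhds (hf δ hδ)
    (fun _ => zero_le) fun n => measure_mono fun ω hω => ?_
  simp only [Set.mem_ofPred_eq] at hω ⊢
  by_contra! hlt
  exact absurd (h hlt) (not_lt.2 hω)

/-- The second order Taylor expansion of the characters, uniformly on the whole line. -/
lemma norm_exp_mul_I_sub_taylor_le (x : ℝ) :
    ‖Complex.exp (x * Complex.I) - (1 + x * Complex.I - x ^ 2 / 2)‖ ≤ 4 * |x| ^ 3 := by
  have hn : ‖(x * Complex.I : ℂ)‖ = |x| := by simp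
  rcases le_total |x| 1 with h | h
  · have := Complex.exp_bound (x := x * Complex.I) (by rw [hn]; exact h) (n := 3) (by norm_num)
    rw [hn] at this
    have he : ∑ m ∈ Finset.range 3, (x * Complex.I : ℂ) ^ m / (m.factorial : ℂ) =
        1 + x * Complex.I - x ^ 2 / 2 := by
      simp only [Finset.sum_range_succ, Finset.sum_range_zero, mul_pow, Complex.I_sq]
      norm_num [Nat.factorial]
      ring
    rw [he] at this
    refine this.trans ?_
    norm_num [Nat.factorial]
    nlinarith [pow_nonneg (abs_nonneg x) 3]
  · have h1 : ‖Complex.exp (x * Complex.I)‖ = 1 := Complex.norm_exp_ofReal_mul_I x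
    have h2 : ‖(1 + x * Complex.I - x ^ 2 / 2 : ℂ)‖ ≤ 1 + |x| + |x| ^ 2 / 2 := by
      refine (norm_sub_le _ _).trans (add_le_add ((norm_add_le _ _).trans ?_) ?_)
      · simp
      · simp
    refine (norm_sub_le _ _).trans ?_
    rw [h1]
    have h3 : |x| ≤ |x| ^ 3 := le_self_pow₀ h (by norm_num)
    have h4 : |x| ^ 2 ≤ |x| ^ 3 := pow_le_pow_right₀ h (by norm_num)
    linarith

lemma norm_prod_sub_prod_le {ι : Type*} (s : Finset ι) {f g : ι → ℂ}
    (hf : ∀ i ∈ s, ‖f i‖ ≤ 1) (hg : ∀ i ∈ s, ‖g i‖ ≤ 1) :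
    ‖∏ i ∈ s, f i - ∏ i ∈ s, g i‖ ≤ ∑ i ∈ s, ‖f i - g i‖ := by
  classical
  induction s using Finset.induction_on with
  | empty => simp
  | insert a s ha ih =>
    rw [Finset.prod_insert ha, Finset.prod_insert ha, Finset.sum_insert ha]
    have ih' := ih (fun i hi => hf i (Finset.mem_insert_of_mem hi))
      fun i hi => hg i (Finset.mem_insert_of_mem hi)
    have hp : ‖∏ i ∈ s, f i‖ ≤ 1 := by
      rw [norm_prod]
      exact Finset.prod_le_one (fun i _ => norm_nonneg _)
        fun i hi => hf i (Finset.mem_insert_of_mem hi)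
    have e : f a * ∏ i ∈ s, f i - g a * ∏ i ∈ s, g i =
        (f a - g a) * ∏ i ∈ s, f i + g a * (∏ i ∈ s, f i - ∏ i ∈ s, g i) := by ring
    rw [e]
    refine (norm_add_le _ _).trans (add_le_add ?_ ?_)
    · rw [norm_mul]
      exact mul_le_of_le_one_right (norm_nonneg _) hp
    · rw [norm_mul]
      exact (mul_le_of_le_one_left (norm_nonneg _) (hg a (Finset.mem_insert_self a s))).trans ih'

variable {Ω : Type*} [MeasurableSpace Ω] {P : Measure Ω}

lemma integrable_pow_four {X : Ω → ℝ} (hX : MemLp X 4 P) : Integrable (fun ω => X ω ^ 4) P := by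
  simpa [Even.pow_abs (show Even 4 by decide)] using
    hX.integrable_norm_pow (p := 4) (by norm_num)

variable [IsProbabilityMeasure P]

/-- The Cauchy-Schwarz inequality between the second and the fourth moments. -/
lemma sq_integral_sq_le {X : Ω → ℝ} (hX : MemLp X 4 P) :
    (∫ ω, X ω ^ 2 ∂P) ^ 2 ≤ ∫ ω, X ω ^ 4 ∂P := by
  have h4 := integrable_pow_four hX
  have h2 : Integrable (fun ω => X ω ^ 2) P :=
    (hX.mono_exponent (by norm_num : (2 : ℝ≥0∞) ≤ 4)).integrable_sq
  set m := ∫ ω, X ω ^ 2 ∂P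
  have : 0 ≤ ∫ ω, (X ω ^ 4 - 2 * m * X ω ^ 2 + m ^ 2) ∂P :=
    integral_nonneg fun ω => by
      have := sq_nonneg (X ω ^ 2 - m)
      simp only [Pi.zero_apply]
      nlinarith
  rw [integral_add (f := fun ω => X ω ^ 4 - 2 * m * X ω ^ 2) (h4.sub (h2.const_mul _))
      (integrable_const _),
    integral_sub h4 (h2.const_mul _), integral_const_mul] at this
  simp only [integral_const, probReal_univ, one_smul] at this
  change 0 ≤ _ - 2 * m * m + m ^ 2 at this
  nlinarith

/-- The characteristic function of a centered variable with four moments against that of the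
centered normal law with the same variance. The free parameter `η` interpolates the third absolute
moment between the second and the fourth moments. -/
lemma norm_charFun_sub_exp_le {X : Ω → ℝ} (hX : MemLp X 4 P) (h0 : ∫ ω, X ω ∂P = 0) (t : ℝ)
    {η : ℝ} (hη : 0 < η) :
    ‖charFun (P.map X) t - Complex.exp (-((t ^ 2 * ∫ ω, X ω ^ 2 ∂P) / 2 : ℝ))‖ ≤
      2 * |t| ^ 3 * (η * ∫ ω, X ω ^ 2 ∂P + η⁻¹ * ∫ ω, X ω ^ 4 ∂P) +
        t ^ 4 * ∫ ω, X ω ^ 4 ∂P := by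
  have h4 := integrable_pow_four hX
  have h2 : Integrable (fun ω => X ω ^ 2) P :=
    (hX.mono_exponent (by norm_num : (2 : ℝ≥0∞) ≤ 4)).integrable_sq
  have h1 : Integrable X P := hX.integrable (by norm_num)
  have hXm := hX.aestronglyMeasurable
  have hsq := sq_integral_sq_le hX
  have hv0 : 0 ≤ ∫ ω, X ω ^ 2 ∂P := integral_nonneg fun ω => by positivity
  set v := ∫ ω, X ω ^ 2 ∂P with hv
  have hexp : Integrable (fun ω => Complex.exp ((t * X ω : ℝ) * Complex.I)) P := by
    refine Integrable.of_bound (C := 1) ?_ (.of_forall fun ω => ?_)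
    · exact Complex.measurable_exp.comp_aemeasurable (by fun_prop) |>.aestronglyMeasurable
    · exact (Complex.norm_exp_ofReal_mul_I _).le
  have hpoly : Integrable (fun ω => (1 + (t * X ω : ℝ) * Complex.I -
      ((t * X ω : ℝ) : ℂ) ^ 2 / 2 : ℂ)) P := by
    refine Integrable.sub (Integrable.add (integrable_const _)
      (((h1.const_mul t).ofReal (𝕜 := ℂ)).mul_const _)) ?_
    refine Integrable.div_const ?_ _
    have := (h2.const_mul (t ^ 2)).ofReal (𝕜 := ℂ)
    refine this.congr (.of_forall fun ω => ?_)
    simp [mul_pow]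
  have hI : ∫ ω, (1 + (t * X ω : ℝ) * Complex.I - ((t * X ω : ℝ) : ℂ) ^ 2 / 2 : ℂ) ∂P =
      ((1 - t ^ 2 * v / 2 : ℝ) : ℂ) := by
    have e2 : ∀ ω, (1 + (t * X ω : ℝ) * Complex.I - ((t * X ω : ℝ) : ℂ) ^ 2 / 2 : ℂ) =
        ((1 - t ^ 2 / 2 * X ω ^ 2 : ℝ) : ℂ) + ((t * X ω : ℝ) : ℂ) * Complex.I := by
      intro ω; push_cast; ring
    simp_rw [e2]
    rw [integral_add, integral_mul_const]
    · rw [integral_complex_ofReal, integral_complex_ofReal, integral_const_mul, h0,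
        integral_sub (integrable_const _) (h2.const_mul _), integral_const_mul]
      simp [← hv]
      ring
    · exact ((integrable_const _).sub (h2.const_mul _)).ofReal
    · exact ((h1.const_mul t).ofReal (𝕜 := ℂ)).mul_const _
  have hA : ‖charFun (P.map X) t - ((1 - t ^ 2 * v / 2 : ℝ) : ℂ)‖ ≤
      2 * |t| ^ 3 * (η * v + η⁻¹ * ∫ ω, X ω ^ 4 ∂P) := by
    have e1 : charFun (P.map X) t = ∫ ω, Complex.exp ((t * X ω : ℝ) * Complex.I) ∂P := by
      rw [charFun_apply_real, integral_map hXm.aemeasurable (by fun_prop)]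
      simp
    rw [e1, ← hI, ← integral_sub hexp hpoly]
    have hb : Integrable (fun ω => 2 * |t| ^ 3 * (η * X ω ^ 2 + η⁻¹ * X ω ^ 4)) P :=
      ((h2.const_mul _).add (h4.const_mul _)).const_mul _
    refine (norm_integral_le_of_norm_le hb (.of_forall fun ω => ?_)).trans_eq ?_
    · refine (norm_exp_mul_I_sub_taylor_le _).trans ?_
      rw [abs_mul, mul_pow]
      have h3 : 2 * |X ω| ^ 3 ≤ η * X ω ^ 2 + η⁻¹ * X ω ^ 4 := by
        rw [← sq_abs (X ω), ← (show |X ω| ^ 4 = X ω ^ 4 from by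
          rw [← abs_pow, abs_of_nonneg (by positivity)])]
        have hk : 0 ≤ |X ω| ^ 2 * η⁻¹ * (|X ω| - η) ^ 2 := by positivity
        have e : |X ω| ^ 2 * η⁻¹ * (|X ω| - η) ^ 2 =
            η * |X ω| ^ 2 + η⁻¹ * |X ω| ^ 4 - 2 * |X ω| ^ 3 := by
          field_simp
          ring
        linarith
      have := mul_le_mul_of_nonneg_left h3 (by positivity : 0 ≤ 2 * |t| ^ 3)
      linarith
    · rw [integral_const_mul, integral_add (h2.const_mul _) (h4.const_mul _), integral_const_mul,
        integral_const_mul]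
  have hB : ‖((1 - t ^ 2 * v / 2 : ℝ) : ℂ) - Complex.exp (-((t ^ 2 * v) / 2 : ℝ))‖ ≤
      t ^ 4 * ∫ ω, X ω ^ 4 ∂P := by
    have hx : 0 ≤ t ^ 2 * v / 2 := by positivity
    have key : ∀ x : ℝ, 0 ≤ x → |1 - x - Real.exp (-x)| ≤ x ^ 2 := by
      intro x hx
      have l1 := Real.add_one_le_exp (-x)
      rw [abs_le]
      refine ⟨?_, by nlinarith⟩
      have l2 := Real.add_one_le_exp x
      have l3 : Real.exp (-x) ≤ (1 + x)⁻¹ := by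
        rw [Real.exp_neg]
        exact inv_anti₀ (by linarith) (by linarith)
      have l4 : (1 + x)⁻¹ ≤ 1 - x + x ^ 2 := by
        rw [inv_le_iff_one_le_mul₀ (by linarith)]
        nlinarith [pow_nonneg hx 3]
      linarith
    rw [← Complex.ofReal_neg, ← Complex.ofReal_exp, ← Complex.ofReal_sub, Complex.norm_real,
      Real.norm_eq_abs]
    refine (key _ hx).trans ?_
    have : t ^ 4 * v ^ 2 ≤ t ^ 4 * ∫ ω, X ω ^ 4 ∂P := mul_le_mul_of_nonneg_left hsq (by positivity)
    have h5 : 0 ≤ t ^ 4 * v ^ 2 := by positivity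
    nlinarith
  refine (norm_sub_le_norm_sub_add_norm_sub _ ((1 - t ^ 2 * v / 2 : ℝ) : ℂ) _).trans ?_
  exact add_le_add hA hB

/-- **Lyapunov's central limit theorem** for a triangular array of centered variables, under the
fourth moment condition. -/
theorem tendstoInDistribution_sum_of_lyapunov {ι : ℕ → Type*} [∀ n, Fintype (ι n)]
    {ξ : (n : ℕ) → ι n → Ω → ℝ} (hindep : ∀ n, iIndepFun (ξ n) P)
    (hmem : ∀ n i, MemLp (ξ n i) 4 P) (hmean : ∀ n i, ∫ ω, ξ n i ω ∂P = 0)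
    (hvar : Tendsto (fun n => ∑ i, ∫ ω, ξ n i ω ^ 2 ∂P) atTop (𝓝 1))
    (hfourth : Tendsto (fun n => ∑ i, ∫ ω, ξ n i ω ^ 4 ∂P) atTop (𝓝 0)) :
    TendstoInDistribution (fun n ω => ∑ i, ξ n i ω) atTop id (fun _ => P)
      (gaussianReal 0 1) where
  forall_aemeasurable n :=
    Finset.aemeasurable_fun_sum _ fun i _ => (hmem n i).aestronglyMeasurable.aemeasurable
  tendsto := by
    refine ProbabilityMeasure.tendsto_iff_tendsto_charFun.2 fun t => ?_
    simp only [ProbabilityMeasure.coe_mk, Measure.map_id, charFun_gaussianReal]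
    have hm n i := (hmem n i).aestronglyMeasurable.aemeasurable
    have hchar : ∀ n, charFun (P.map fun ω => ∑ i, ξ n i ω) t =
        ∏ i, charFun (P.map (ξ n i)) t := fun n => by
      rw [(hindep n).charFun_map_fun_sum_eq_prod (hm n), Finset.prod_apply]
    simp_rw [hchar]
    set v : (n : ℕ) → ι n → ℝ := fun n i => ∫ ω, ξ n i ω ^ 2 ∂P with hv
    have hv0 : ∀ n i, 0 ≤ v n i := fun n i => integral_nonneg fun ω => by positivity
    have hG : Tendsto (fun n => ∏ i, Complex.exp (-((t ^ 2 * v n i) / 2 : ℝ))) atTop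
        (𝓝 (Complex.exp (-((t ^ 2 * 1) / 2 : ℝ)))) := by
      have : ∀ n, ∏ i, Complex.exp (-((t ^ 2 * v n i) / 2 : ℝ)) =
          Complex.exp (-((t ^ 2 * ∑ i, v n i) / 2 : ℝ)) := fun n => by
        rw [← Complex.exp_sum, Finset.sum_neg_distrib, ← Complex.ofReal_sum, ← Finset.sum_div,
          ← Finset.mul_sum]
      simp_rw [this]
      refine (Complex.continuous_exp.tendsto _).comp (Tendsto.neg ?_)
      exact (Complex.continuous_ofReal.tendsto _).comp ((hvar.const_mul _).div_const _)
    have hD : Tendsto (fun n => ∏ i, charFun (P.map (ξ n i)) t -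
        ∏ i, Complex.exp (-((t ^ 2 * v n i) / 2 : ℝ))) atTop (𝓝 0) := by
      rw [tendsto_zero_iff_norm_tendsto_zero]
      have hle : ∀ η : ℝ, 0 < η → ∀ n, ‖∏ i, charFun (P.map (ξ n i)) t -
          ∏ i, Complex.exp (-((t ^ 2 * v n i) / 2 : ℝ))‖ ≤
          2 * |t| ^ 3 * (η * ∑ i, v n i + η⁻¹ * ∑ i, ∫ ω, ξ n i ω ^ 4 ∂P) +
            t ^ 4 * ∑ i, ∫ ω, ξ n i ω ^ 4 ∂P := by
        intro η hη n
        refine (norm_prod_sub_prod_le _ ?_ ?_).trans ?_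
        · intro i _
          have := Measure.isProbabilityMeasure_map (hm n i)
          exact norm_charFun_le_one (μ := P.map (ξ n i)) t
        · intro i _
          rw [← Complex.ofReal_neg, ← Complex.ofReal_exp, Complex.norm_real, Real.norm_eq_abs,
            Real.abs_exp]
          exact Real.exp_le_one_iff.2 (by have := hv0 n i; rw [neg_nonpos]; positivity)
        · refine (Finset.sum_le_sum fun i _ =>
            norm_charFun_sub_exp_le (hmem n i) (hmean n i) t hη).trans_eq ?_
          rw [Finset.sum_add_distrib, ← Finset.mul_sum, ← Finset.mul_sum, Finset.sum_add_distrib,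
            ← Finset.mul_sum, ← Finset.mul_sum]
      rw [Metric.tendsto_atTop']
      intro r hr
      -- for fixed `η` the bound tends to `2 |t|³ η`, which is below `r`
      set η : ℝ := r / (4 * (|t| ^ 3 + 1)) with hη
      have hη0 : 0 < η := by positivity
      have hlim : Tendsto (fun n => 2 * |t| ^ 3 *
          (η * ∑ i, v n i + η⁻¹ * ∑ i, ∫ ω, ξ n i ω ^ 4 ∂P) +
            t ^ 4 * ∑ i, ∫ ω, ξ n i ω ^ 4 ∂P) atTop
          (𝓝 (2 * |t| ^ 3 * (η * 1 + η⁻¹ * 0) + t ^ 4 * 0)) :=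
        (((hvar.const_mul η).add (hfourth.const_mul _)).const_mul _).add (hfourth.const_mul _)
      have hlt : 2 * |t| ^ 3 * (η * 1 + η⁻¹ * 0) + t ^ 4 * 0 < r := by
        have : η * (4 * (|t| ^ 3 + 1)) = r := by rw [hη]; field_simp
        have h3 : 0 ≤ |t| ^ 3 := by positivity
        nlinarith
      obtain ⟨N, hN⟩ := eventually_atTop.1 (hlim.eventually (gt_mem_nhds hlt))
      refine ⟨N, fun n hn => ?_⟩
      rw [Real.dist_eq, sub_zero, abs_of_nonneg (norm_nonneg _)]
      exact (hle η hη0 n).trans_lt (hN n hn.le)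
    have := hD.add hG
    simp only [sub_add_cancel, zero_add] at this
    convert this using 2
    push_cast
    simp

end Probability

/-! ### Least squares under an orthogonal design -/

section Regression

/-- The standardized noise `n^{-1/2} ∑ᵢ x_{i,k} εᵢ` in the direction of the `k`-th covariate. -/
def scoreNoise {n K : ℕ} (X : Matrix (Fin n) (Fin K) ℝ) (e : Fin n → ℝ) (k : Fin K) : ℝ :=
  (√(n : ℝ))⁻¹ * ∑ i, X i k * e i

variable {n K : ℕ} {X : Matrix (Fin n) (Fin K) ℝ}

lemma transpose_mul_self_of_orthogonal (hn : 0 < n) (h : (n : ℝ)⁻¹ • (Xᵀ * X) = 1) :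
    Xᵀ * X = (n : ℝ) • (1 : Matrix (Fin K) (Fin K) ℝ) := by
  rw [← h, smul_smul, mul_inv_cancel₀ (by positivity), one_smul]

lemma sum_mul_of_orthogonal (hX : Xᵀ * X = (n : ℝ) • (1 : Matrix (Fin K) (Fin K) ℝ))
    (j k : Fin K) : ∑ i, X i j * X i k = if j = k then (n : ℝ) else 0 := by
  have := congrFun (congrFun hX j) k
  simpa [Matrix.mul_apply, Matrix.one_apply] using this

lemma sum_sq_mulVec (hX : Xᵀ * X = (n : ℝ) • (1 : Matrix (Fin K) (Fin K) ℝ)) (b : Fin K → ℝ) :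
    ∑ i, (X *ᵥ b) i ^ 2 = n * ∑ k, b k ^ 2 := by
  have h : (X *ᵥ b) ⬝ᵥ (X *ᵥ b) = (n : ℝ) * (b ⬝ᵥ b) := by
    rw [Matrix.dotProduct_mulVec, Matrix.vecMul_mulVec, hX]
    simp [Matrix.vecMul_smul]
  simpa [dotProduct, sq] using h

lemma sum_mulVec_mul (b : Fin K → ℝ) (y : Fin n → ℝ) :
    ∑ i, (X *ᵥ b) i * y i = ∑ k, b k * (Xᵀ *ᵥ y) k := by
  have : (X *ᵥ b) ⬝ᵥ y = b ⬝ᵥ (Xᵀ *ᵥ y) := by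
    rw [Matrix.dotProduct_mulVec, Matrix.vecMul_transpose]
  simpa [dotProduct] using this

lemma transpose_mulVec_eq (hn : 0 < n) (e : Fin n → ℝ) :
    Xᵀ *ᵥ e = fun k => √(n : ℝ) * scoreNoise X e k := by
  have : √(n : ℝ) ≠ 0 := by positivity
  ext k
  simp [scoreNoise, Matrix.mulVec, dotProduct, this]

lemma olsEstimate_response (hn : 0 < n)
    (hX : Xᵀ * X = (n : ℝ) • (1 : Matrix (Fin K) (Fin K) ℝ)) (β₀ : Fin K → ℝ) (e : Fin n → ℝ) :
    olsEstimate X (response X β₀ e) = fun k => β₀ k + (√(n : ℝ))⁻¹ * scoreNoise X e k := by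
  have hn' : (n : ℝ) ≠ 0 := by positivity
  have hr : response X β₀ e = X *ᵥ β₀ + e := rfl
  have hinv : ((n : ℝ) • (1 : Matrix (Fin K) (Fin K) ℝ))⁻¹ = (n : ℝ)⁻¹ • 1 := by
    refine Matrix.inv_eq_right_inv ?_
    simp [smul_smul, hn']
  have hs : (n : ℝ)⁻¹ * √(n : ℝ) = (√(n : ℝ))⁻¹ := by
    rw [← Real.sqrt_div_self, div_eq_inv_mul]
  ext k
  rw [olsEstimate, hr, Matrix.mulVec_add, Matrix.mulVec_mulVec, hX, hinv, transpose_mulVec_eq hn]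
  simp [Matrix.smul_mulVec, mul_add, ← mul_assoc, hn', hs]

/-- The residual sum of squares is the total noise minus its projection on the covariates. -/
lemma sum_sq_residual (hn : 0 < n)
    (hX : Xᵀ * X = (n : ℝ) • (1 : Matrix (Fin K) (Fin K) ℝ)) (β₀ : Fin K → ℝ) (e : Fin n → ℝ) :
    ∑ i, (response X β₀ e i - (X *ᵥ olsEstimate X (response X β₀ e)) i) ^ 2 =
      ∑ i, e i ^ 2 - ∑ k, scoreNoise X e k ^ 2 := by
  have hs : √(n : ℝ) ≠ 0 := by positivity
  have hs2 : √(n : ℝ) ^ 2 = n := Real.sq_sqrt (by positivity)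
  set d : Fin K → ℝ := fun k => (√(n : ℝ))⁻¹ * scoreNoise X e k with hd
  have hb : olsEstimate X (response X β₀ e) = β₀ + d := olsEstimate_response hn hX β₀ e
  have hres : ∀ i, response X β₀ e i - (X *ᵥ olsEstimate X (response X β₀ e)) i =
      e i - (X *ᵥ d) i := fun i => by
    rw [hb, Matrix.mulVec_add, Pi.add_apply, response]
    ring
  have h1 := sum_sq_mulVec hX d
  have h2 := sum_mulVec_mul (X := X) d e
  have h3 : ∑ k, d k * (Xᵀ *ᵥ e) k = ∑ k, scoreNoise X e k ^ 2 := by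
    rw [transpose_mulVec_eq hn]
    refine Finset.sum_congr rfl fun k _ => ?_
    simp only [hd]
    field_simp
  have h4 : (n : ℝ) * ∑ k, d k ^ 2 = ∑ k, scoreNoise X e k ^ 2 := by
    rw [Finset.mul_sum]
    refine Finset.sum_congr rfl fun k _ => ?_
    simp only [hd, mul_pow, inv_pow, hs2]
    have : (n : ℝ) ≠ 0 := by positivity
    field_simp
  calc ∑ i, (response X β₀ e i - (X *ᵥ olsEstimate X (response X β₀ e)) i) ^ 2
      = ∑ i, (e i ^ 2 - 2 * ((X *ᵥ d) i * e i) + (X *ᵥ d) i ^ 2) :=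
        Finset.sum_congr rfl fun i _ => by rw [hres]; ring
    _ = _ := by
        rw [Finset.sum_add_distrib, Finset.sum_sub_distrib, ← Finset.mul_sum, h1, h2, h3, h4]
        ring

/-- Under an orthogonal design, `ξₖ` is the signal `√n β₀ₖ` plus the standardized noise, divided
by the estimated standard deviation. -/
lemma xi_response (hn : 0 < n)
    (hX : Xᵀ * X = (n : ℝ) • (1 : Matrix (Fin K) (Fin K) ℝ)) (β₀ : Fin K → ℝ) (e : Fin n → ℝ)
    (k : Fin K) :
    xi X (response X β₀ e) k =
      (sigmaHat X (response X β₀ e))⁻¹ * (√(n : ℝ) * β₀ k + scoreNoise X e k) := by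
  have h : Xᵀ *ᵥ response X β₀ e = fun k => (n : ℝ) * β₀ k + √(n : ℝ) * scoreNoise X e k := by
    have hr : response X β₀ e = X *ᵥ β₀ + e := rfl
    rw [hr, Matrix.mulVec_add, Matrix.mulVec_mulVec, hX, transpose_mulVec_eq hn]
    ext k
    simp [Matrix.smul_mulVec]
  have hk : ∑ i, X i k * response X β₀ e i =
      (n : ℝ) * β₀ k + √(n : ℝ) * scoreNoise X e k := congrFun h k
  have hs : √(n : ℝ) ≠ 0 := by positivity
  have hs2 : √(n : ℝ) * √(n : ℝ) = n := Real.mul_self_sqrt (by positivity)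
  have e1 : (n : ℝ) * β₀ k + √(n : ℝ) * scoreNoise X e k =
      √(n : ℝ) * (√(n : ℝ) * β₀ k + scoreNoise X e k) := by rw [mul_add, ← mul_assoc, hs2]
  rw [xi, hk, e1, mul_assoc, inv_mul_cancel_left₀ hs]

end Regression

/-! ### Moments of the noise and of the variance estimate -/

section Errors

variable {Ω : Type*} [MeasurableSpace Ω] {P : Measure Ω}
  {n K : ℕ} {X : Matrix (Fin n) (Fin K) ℝ} {e : Fin n → Ω → ℝ} {σ₀ M : ℝ}

lemma memLp_scoreNoise {p : ℝ≥0∞} (he : ∀ i, MemLp (e i) p P) (k : Fin K) :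
    MemLp (fun ω => scoreNoise X (fun i => e i ω) k) p P := by
  unfold scoreNoise
  exact (memLp_finsetSum _ fun i _ => (he i).const_mul (X i k)).const_mul _

variable [IsProbabilityMeasure P]

lemma integral_sq_scoreNoise (hn : 0 < n)
    (hX : Xᵀ * X = (n : ℝ) • (1 : Matrix (Fin K) (Fin K) ℝ))
    (hindep : iIndepFun e P) (hmem : ∀ i, MemLp (e i) 2 P) (hmean : ∀ i, ∫ ω, e i ω ∂P = 0)
    (hvar : ∀ i, ∫ ω, e i ω ^ 2 ∂P = σ₀ ^ 2) (k : Fin K) :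
    ∫ ω, scoreNoise X (fun i => e i ω) k ^ 2 ∂P = σ₀ ^ 2 := by
  have hint : ∀ i, Integrable (e i) P := fun i => (hmem i).integrable (by norm_num)
  have hmul : ∀ i, MemLp (fun ω => X i k * e i ω) 2 P := fun i => (hmem i).const_mul _
  have h0 : ∫ ω, ∑ i, X i k * e i ω ∂P = 0 := by
    rw [integral_finsetSum _ fun i _ => (hint i).const_mul _]
    simp [integral_const_mul, hmean]
  have hv : ∫ ω, (∑ i, X i k * e i ω) ^ 2 ∂P = n * σ₀ ^ 2 := by
    rw [← variance_of_integral_eq_zero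
      (Finset.aemeasurable_fun_sum _ fun i _ => (hmul i).aestronglyMeasurable.aemeasurable) h0]
    have hs := IndepFun.variance_sum (s := Finset.univ) (X := fun i ω => X i k * e i ω)
      (fun i _ => hmul i) (fun i _ j _ hij =>
        (hindep.indepFun hij).comp (measurable_const_mul (X i k)) (measurable_const_mul (X j k)))
    have e1 : (∑ i, fun ω => X i k * e i ω) = fun ω => ∑ i, X i k * e i ω := by
      ext ω; simp
    rw [e1] at hs
    rw [hs]
    have e2 : ∀ i, Var[fun ω => X i k * e i ω; P] = X i k * X i k * σ₀ ^ 2 := fun i => by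
      rw [variance_const_mul, variance_of_integral_eq_zero
        (hmem i).aestronglyMeasurable.aemeasurable (hmean i), hvar, sq (X i k)]
    simp_rw [e2]
    rw [← Finset.sum_mul, sum_mul_of_orthogonal hX, if_pos rfl]
  have hn' : (n : ℝ) ≠ 0 := by positivity
  simp only [scoreNoise, mul_pow, inv_pow]
  rw [integral_const_mul, hv, Real.sq_sqrt (by positivity)]
  field_simp

/-- A quantitative weak law for the squared errors: the deviation of their sum has order `√n` in
mean. -/
lemma integral_abs_sum_sq_sub_le (hn : 0 < n)
    (hindep : iIndepFun e P) (hmem : ∀ i, MemLp (e i) 4 P)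
    (hvar : ∀ i, ∫ ω, e i ω ^ 2 ∂P = σ₀ ^ 2) (hfourth : ∀ i, ∫ ω, e i ω ^ 4 ∂P ≤ M) :
    ∫ ω, |∑ i, (e i ω ^ 2 - σ₀ ^ 2)| ∂P ≤ √(n : ℝ) * (M + 1) / 2 := by
  have hm i := (hmem i).aestronglyMeasurable.aemeasurable
  have h4 : ∀ i, Integrable (fun ω => e i ω ^ 4) P := fun i => integrable_pow_four (hmem i)
  have hsq : ∀ i, MemLp (fun ω => e i ω ^ 2) 2 P := fun i => by
    rw [memLp_two_iff_integrable_sq ((hm i).pow_const 2).aestronglyMeasurable]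
    refine (h4 i).congr (.of_forall fun ω => ?_)
    ring
  have hU : ∀ i, MemLp (fun ω => e i ω ^ 2 - σ₀ ^ 2) 2 P := fun i => (hsq i).sub (memLp_const _)
  have hS : MemLp (fun ω => ∑ i, (e i ω ^ 2 - σ₀ ^ 2)) 2 P := memLp_finsetSum _ fun i _ => hU i
  have h0 : ∀ i, ∫ ω, (e i ω ^ 2 - σ₀ ^ 2) ∂P = 0 := fun i => by
    rw [integral_sub ((hsq i).integrable (by norm_num)) (integrable_const _), hvar]
    simp
  have hv : ∫ ω, (∑ i, (e i ω ^ 2 - σ₀ ^ 2)) ^ 2 ∂P ≤ n * M := by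
    rw [← variance_of_integral_eq_zero hS.aestronglyMeasurable.aemeasurable (by
      rw [integral_finsetSum _ fun i _ => (hU i).integrable (by norm_num)]
      simp [h0])]
    have hs := IndepFun.variance_sum (s := Finset.univ) (X := fun i ω => e i ω ^ 2 - σ₀ ^ 2)
      (fun i _ => hU i) (fun i _ j _ hij =>
        (hindep.indepFun hij).comp (φ := fun x : ℝ => x ^ 2 - σ₀ ^ 2)
          (ψ := fun x : ℝ => x ^ 2 - σ₀ ^ 2) (by fun_prop) (by fun_prop))
    have e1 : (∑ i, fun ω => e i ω ^ 2 - σ₀ ^ 2) = fun ω => ∑ i, (e i ω ^ 2 - σ₀ ^ 2) := by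
      ext ω; simp
    rw [e1] at hs
    rw [hs]
    have e2 : ∀ i, Var[fun ω => e i ω ^ 2 - σ₀ ^ 2; P] ≤ M := fun i => by
      rw [variance_sub_const ((hm i).pow_const 2).aestronglyMeasurable]
      refine (variance_le_expectation_sq ((hm i).pow_const 2).aestronglyMeasurable).trans ?_
      refine le_trans (le_of_eq ?_) (hfourth i)
      refine integral_congr_ae (.of_forall fun ω => ?_)
      simp only [Pi.pow_apply]
      ring
    refine (Finset.sum_le_sum fun i _ => e2 i).trans ?_
    simp
  have hs0 : 0 < √(n : ℝ) := by positivity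
  have hs2 : √(n : ℝ) ^ 2 = n := Real.sq_sqrt (by positivity)
  -- the inequality `2 |x| ≤ x² / √n + √n` replaces the Cauchy-Schwarz inequality
  have hb : Integrable (fun ω => ((√(n : ℝ))⁻¹ * (∑ i, (e i ω ^ 2 - σ₀ ^ 2)) ^ 2 + √(n : ℝ)) / 2)
      P := ((hS.integrable_sq.const_mul _).add (integrable_const _)).div_const _
  refine (integral_mono (hS.integrable (by norm_num)).abs hb fun ω => ?_).trans ?_
  · simp only
    set x := ∑ i, (e i ω ^ 2 - σ₀ ^ 2)
    rw [← sq_abs x]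
    have h : 0 ≤ (√(n : ℝ))⁻¹ * (|x| - √(n : ℝ)) ^ 2 := by positivity
    have h' : (√(n : ℝ))⁻¹ * (|x| - √(n : ℝ)) ^ 2 =
        (√(n : ℝ))⁻¹ * |x| ^ 2 + √(n : ℝ) - 2 * |x| := by
      field_simp
      ring
    linarith
  · rw [integral_div, integral_add (hS.integrable_sq.const_mul _) (integrable_const _),
      integral_const_mul]
    simp only [integral_const, probReal_univ, one_smul]
    have : (√(n : ℝ))⁻¹ * ∫ ω, (∑ i, (e i ω ^ 2 - σ₀ ^ 2)) ^ 2 ∂P ≤ √(n : ℝ) * M := by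
      rw [inv_mul_le_iff₀ hs0, ← mul_assoc, ← sq, hs2]
      exact hv
    linarith

/-- The variance estimate is close to `σ₀²` in mean: the bound has order `n^{-1/2}`. -/
lemma integral_abs_sq_sigmaHat_sub_le (hKn : K < n)
    (hX : Xᵀ * X = (n : ℝ) • (1 : Matrix (Fin K) (Fin K) ℝ))
    (hindep : iIndepFun e P) (hmem : ∀ i, MemLp (e i) 4 P) (hmean : ∀ i, ∫ ω, e i ω ∂P = 0)
    (hvar : ∀ i, ∫ ω, e i ω ^ 2 ∂P = σ₀ ^ 2) (hfourth : ∀ i, ∫ ω, e i ω ^ 4 ∂P ≤ M)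
    (β₀ : Fin K → ℝ) :
    Integrable (fun ω => sigmaHat X (response X β₀ fun i => e i ω) ^ 2 - σ₀ ^ 2) P ∧
    ∫ ω, |sigmaHat X (response X β₀ fun i => e i ω) ^ 2 - σ₀ ^ 2| ∂P ≤
      (√(n : ℝ) * (M + 1) / 2 + 2 * K * σ₀ ^ 2) / ((n : ℝ) - K) := by
  have hn : 0 < n := by omega
  have hnK : 0 < (n : ℝ) - K := sub_pos.2 (by exact_mod_cast hKn)
  have hmem2 : ∀ i, MemLp (e i) 2 P := fun i => (hmem i).mono_exponent (by norm_num)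
  have hformula : ∀ ω, sigmaHat X (response X β₀ fun i => e i ω) ^ 2 - σ₀ ^ 2 =
      (∑ i, (e i ω ^ 2 - σ₀ ^ 2) - ∑ k, scoreNoise X (fun i => e i ω) k ^ 2 + K * σ₀ ^ 2) /
        ((n : ℝ) - K) := by
    intro ω
    rw [sigmaHat, Real.sq_sqrt (div_nonneg (Finset.sum_nonneg fun i _ => sq_nonneg _) hnK.le),
      sum_sq_residual hn hX, Finset.sum_sub_distrib]
    simp only [Finset.sum_const, Finset.card_univ, Fintype.card_fin, nsmul_eq_mul]
    field_simp
    ring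
  have hI1 : Integrable (fun ω => ∑ i, (e i ω ^ 2 - σ₀ ^ 2)) P :=
    integrable_finsetSum _ fun i _ => (hmem2 i).integrable_sq.sub (integrable_const _)
  have hI2 : Integrable (fun ω => ∑ k, scoreNoise X (fun i => e i ω) k ^ 2) P :=
    integrable_finsetSum _ fun k _ => (memLp_scoreNoise hmem2 k).integrable_sq
  refine ⟨?_, ?_⟩
  · simp_rw [hformula]
    exact ((hI1.sub hI2).add (integrable_const _)).div_const _
  · have hb : Integrable (fun ω => (|∑ i, (e i ω ^ 2 - σ₀ ^ 2)| +
        ∑ k, scoreNoise X (fun i => e i ω) k ^ 2 + K * σ₀ ^ 2) / ((n : ℝ) - K)) P :=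
      ((hI1.abs.add hI2).add (integrable_const _)).div_const _
    have hI : Integrable (fun ω =>
        |sigmaHat X (response X β₀ fun i => e i ω) ^ 2 - σ₀ ^ 2|) P := by
      simp_rw [hformula]
      exact (((hI1.sub hI2).add (integrable_const _)).div_const _).abs
    refine (integral_mono hI hb fun ω => ?_).trans ?_
    · simp only [hformula]
      rw [abs_div, abs_of_pos hnK]
      refine div_le_div_of_nonneg_right ?_ hnK.le
      have h2 : 0 ≤ ∑ k, scoreNoise X (fun i => e i ω) k ^ 2 :=
        Finset.sum_nonneg fun k _ => sq_nonneg _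
      have h3 : 0 ≤ (K : ℝ) * σ₀ ^ 2 := by positivity
      rw [abs_le]
      have := neg_abs_le (∑ i, (e i ω ^ 2 - σ₀ ^ 2))
      have := le_abs_self (∑ i, (e i ω ^ 2 - σ₀ ^ 2))
      constructor <;> linarith
    · rw [integral_div]
      refine div_le_div_of_nonneg_right ?_ hnK.le
      rw [integral_add (f := fun ω => |∑ i, (e i ω ^ 2 - σ₀ ^ 2)| +
        ∑ k, scoreNoise X (fun i => e i ω) k ^ 2) (hI1.abs.add hI2) (integrable_const _),
        integral_add hI1.abs hI2,
        integral_finsetSum _ fun k _ => (memLp_scoreNoise hmem2 k).integrable_sq]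
      simp_rw [integral_sq_scoreNoise hn hX hindep hmem2 hmean hvar]
      have := integral_abs_sum_sq_sub_le hn hindep hmem hvar hfourth
      simp only [integral_const, probReal_univ, one_smul, Finset.sum_const, Finset.card_univ,
        Fintype.card_fin, nsmul_eq_mul]
      linarith

end Errors

/-! ### Consistency of the estimates and the null limit of `ξ` -/

section Asymptotics

variable {Ω : Type*} [MeasurableSpace Ω] {P : Measure Ω} {K : ℕ}
  {X : (n : ℕ) → Matrix (Fin n) (Fin K) ℝ} {ε : (n : ℕ) → Fin n → Ω → ℝ} {σ₀ M : ℝ}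
  {β₀ : Fin K → ℝ}

lemma aemeasurable_xi {n : ℕ} {A : Matrix (Fin n) (Fin K) ℝ} {Y : Ω → Fin n → ℝ}
    (hY : ∀ i, AEMeasurable (fun ω => Y ω i) P) (k : Fin K) :
    AEMeasurable (fun ω => xi A (Y ω) k) P := by
  have hY' : AEMeasurable Y P := aemeasurable_pi_lambda _ hY
  have : Measurable fun y : Fin n → ℝ => xi A y k := by
    unfold xi sigmaHat olsEstimate Matrix.mulVec dotProduct
    fun_prop
  exact this.comp_aemeasurable hY'

lemma aemeasurable_sigmaHat {n : ℕ} {A : Matrix (Fin n) (Fin K) ℝ} {Y : Ω → Fin n → ℝ}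
    (hY : ∀ i, AEMeasurable (fun ω => Y ω i) P) :
    AEMeasurable (fun ω => sigmaHat A (Y ω)) P := by
  have hY' : AEMeasurable Y P := aemeasurable_pi_lambda _ hY
  have : Measurable fun y : Fin n → ℝ => sigmaHat A y := by
    unfold sigmaHat olsEstimate Matrix.mulVec dotProduct
    fun_prop
  exact this.comp_aemeasurable hY'

variable [IsProbabilityMeasure P]

/-- Consistency of the variance estimate. -/
lemma tendstoInMeasure_sq_sigmaHat (hX : OrthogonalDesign X) (hindep : ∀ n, iIndepFun (ε n) P)
    (hmem : ∀ n i, MemLp (ε n i) 4 P) (hmean : ∀ n i, ∫ ω, ε n i ω ∂P = 0)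
    (hvar : ∀ n i, ∫ ω, ε n i ω ^ 2 ∂P = σ₀ ^ 2) (hfourth : ∀ n i, ∫ ω, ε n i ω ^ 4 ∂P ≤ M) :
    TendstoInMeasure P
      (fun n ω => sigmaHat (X n) (response (X n) β₀ fun i => ε n i ω) ^ 2) atTop
      fun _ => σ₀ ^ 2 := by
  have hbound : Tendsto (fun n : ℕ => (√(n : ℝ) * (M + 1) / 2 + 2 * K * σ₀ ^ 2) / ((n : ℝ) - K))
      atTop (𝓝 0) := by
    have hs : Tendsto (fun n : ℕ => (√(n : ℝ))⁻¹) atTop (𝓝 0) :=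
      tendsto_inv_atTop_zero.comp (Real.tendsto_sqrt_atTop.comp tendsto_natCast_atTop_atTop)
    have hi : Tendsto (fun n : ℕ => (n : ℝ)⁻¹) atTop (𝓝 0) := tendsto_inv_atTop_nhds_zero_nat
    have h1 : Tendsto (fun n : ℕ => ((√(n : ℝ))⁻¹ * ((M + 1) / 2) + 2 * K * σ₀ ^ 2 * (n : ℝ)⁻¹) /
        (1 - K * (n : ℝ)⁻¹)) atTop (𝓝 ((0 * ((M + 1) / 2) + 2 * K * σ₀ ^ 2 * 0) / (1 - K * 0))) :=
      ((hs.mul_const _).add (hi.const_mul _)).div ((hi.const_mul _).const_sub _) (by norm_num)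
    simp only [zero_mul, mul_zero, add_zero, zero_div] at h1
    refine h1.congr' ?_
    filter_upwards [eventually_gt_atTop 0] with n hn
    have hn' : (n : ℝ) ≠ 0 := by positivity
    have hq : (√(n : ℝ))⁻¹ = √(n : ℝ) * (n : ℝ)⁻¹ := by
      rw [← Real.sqrt_div_self, div_eq_mul_inv]
    rw [hq, ← mul_div_mul_right _ ((n : ℝ) - K) (inv_ne_zero hn')]
    congr 1
    · ring
    · rw [sub_mul, mul_inv_cancel₀ hn']
  rw [tendstoInMeasure_iff_norm]
  intro r hr
  -- Markov's inequality
  have hmarkov : ∀ n, K < n → P {ω | r ≤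
      ‖sigmaHat (X n) (response (X n) β₀ fun i => ε n i ω) ^ 2 - σ₀ ^ 2‖} ≤
      ENNReal.ofReal (((√(n : ℝ) * (M + 1) / 2 + 2 * K * σ₀ ^ 2) / ((n : ℝ) - K)) / r) := by
    intro n hn
    obtain ⟨hint, hle⟩ := integral_abs_sq_sigmaHat_sub_le hn
      (transpose_mul_self_of_orthogonal (by omega) (hX n hn)) (hindep n) (hmem n) (hmean n)
      (hvar n) (hfourth n) β₀
    have := mul_meas_ge_le_integral_of_nonneg (.of_forall fun ω => abs_nonneg _) hint.abs r
    rw [← ofReal_measureReal]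
    refine ENNReal.ofReal_le_ofReal ?_
    rw [le_div_iff₀ hr, mul_comm]
    exact this.trans hle
  have hlim := ENNReal.tendsto_ofReal (hbound.div_const r)
  rw [zero_div, ENNReal.ofReal_zero] at hlim
  refine tendsto_of_tendsto_of_tendsto_of_le_of_le' tendsto_const_nhds hlim
    (.of_forall fun _ => zero_le) ?_
  filter_upwards [eventually_gt_atTop K] with n hn using hmarkov n hn

/-- The least squares estimates are consistent. -/
lemma tendstoInMeasure_scoreNoise_div_sqrt (hX : OrthogonalDesign X)
    (hindep : ∀ n, iIndepFun (ε n) P)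
    (hmem : ∀ n i, MemLp (ε n i) 2 P) (hmean : ∀ n i, ∫ ω, ε n i ω ∂P = 0)
    (hvar : ∀ n i, ∫ ω, ε n i ω ^ 2 ∂P = σ₀ ^ 2) (k : Fin K) :
    TendstoInMeasure P
      (fun (n : ℕ) ω => (√(n : ℝ))⁻¹ * scoreNoise (X n) (fun i => ε n i ω) k) atTop fun _ => 0 := by
  rw [tendstoInMeasure_iff_norm]
  intro r hr
  have hmarkov : ∀ n, K < n → P {ω | r ≤
      ‖(√(n : ℝ))⁻¹ * scoreNoise (X n) (fun i => ε n i ω) k - 0‖} ≤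
      ENNReal.ofReal (σ₀ ^ 2 * (n : ℝ)⁻¹ / r ^ 2) := by
    intro n hn
    have hn0 : 0 < n := by omega
    have h2 := integral_sq_scoreNoise hn0
      (transpose_mul_self_of_orthogonal (by omega) (hX n hn)) (hindep n) (hmem n) (hmean n)
      (hvar n) k
    have hint := ((memLp_scoreNoise (X := X n) (hmem n) k).const_mul (√(n : ℝ))⁻¹).integrable_sq
    have := mul_meas_ge_le_integral_of_nonneg (.of_forall fun ω => sq_nonneg _) hint (r ^ 2)
    rw [← ofReal_measureReal]
    refine ENNReal.ofReal_le_ofReal ?_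
    rw [le_div_iff₀ (by positivity), mul_comm]
    have hset : {ω | r ≤ ‖(√(n : ℝ))⁻¹ * scoreNoise (X n) (fun i => ε n i ω) k - 0‖} =
        {ω | r ^ 2 ≤ ((√(n : ℝ))⁻¹ * scoreNoise (X n) (fun i => ε n i ω) k) ^ 2} := by
      ext ω
      simp only [Set.mem_ofPred_eq, sub_zero, Real.norm_eq_abs]
      rw [sq_le_sq, abs_of_pos hr]
    rw [hset]
    refine this.trans_eq ?_
    simp only [mul_pow, inv_pow, Real.sq_sqrt (Nat.cast_nonneg n)]
    rw [integral_const_mul, h2, mul_comm]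
  have hlim := ENNReal.tendsto_ofReal
    (((tendsto_inv_atTop_nhds_zero_nat (𝕜 := ℝ)).const_mul (σ₀ ^ 2)).div_const (r ^ 2))
  rw [mul_zero, zero_div, ENNReal.ofReal_zero] at hlim
  refine tendsto_of_tendsto_of_tendsto_of_le_of_le' tendsto_const_nhds hlim
    (.of_forall fun _ => zero_le) ?_
  filter_upwards [eventually_gt_atTop K] with n hn using hmarkov n hn

/-- Asymptotic normality of the standardized noise: negligible covariates turn the fourth moment
bound into Lyapunov's condition. -/
lemma tendstoInDistribution_scoreNoise (hσ₀ : 0 < σ₀) (hD2 : NegligibleCovariates X)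
    (hX : OrthogonalDesign X) (hindep : ∀ n, iIndepFun (ε n) P)
    (hmem : ∀ n i, MemLp (ε n i) 4 P) (hmean : ∀ n i, ∫ ω, ε n i ω ∂P = 0)
    (hvar : ∀ n i, ∫ ω, ε n i ω ^ 2 ∂P = σ₀ ^ 2) (hfourth : ∀ n i, ∫ ω, ε n i ω ^ 4 ∂P ≤ M)
    (k : Fin K) :
    TendstoInDistribution (fun n ω => σ₀⁻¹ * scoreNoise (X n) (fun i => ε n i ω) k) atTop id
      (fun _ => P) (gaussianReal 0 1) := by
  set a : (n : ℕ) → Fin n → ℝ := fun n i => σ₀⁻¹ * (√(n : ℝ))⁻¹ * X n i k with ha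
  have hsum : ∀ n ω, σ₀⁻¹ * scoreNoise (X n) (fun i => ε n i ω) k = ∑ i, a n i * ε n i ω := by
    intro n ω
    simp only [scoreNoise, ha, Finset.mul_sum]
    exact Finset.sum_congr rfl fun i _ => by ring
  have ha2 : ∀ n, K < n → ∑ i, a n i ^ 2 = (σ₀ ^ 2)⁻¹ := by
    intro n hn
    have hn' : (n : ℝ) ≠ 0 := by have : 0 < n := by omega
                                 positivity
    have := sum_mul_of_orthogonal (transpose_mul_self_of_orthogonal (by omega) (hX n hn)) k k
    rw [if_pos rfl] at this
    simp only [ha, mul_pow, inv_pow, Real.sq_sqrt (Nat.cast_nonneg n), ← Finset.mul_sum]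
    simp only [sq (X n _ k), this]
    field_simp
  have hmax : ∀ n i, a n i ^ 2 ≤
      (σ₀⁻¹ * ((⨆ i : Fin n, ‖WithLp.toLp 2 (X n i)‖) / √(n : ℝ))) ^ 2 := by
    intro n i
    rw [sq_le_sq, ha]
    simp only [abs_mul, abs_inv, abs_div, abs_of_pos hσ₀, abs_of_nonneg (Real.sqrt_nonneg _)]
    rw [mul_assoc, div_eq_inv_mul]
    have h1 : |X n i k| ≤ ‖WithLp.toLp 2 (X n i)‖ := by
      simpa using PiLp.norm_apply_le (WithLp.toLp 2 (X n i)) k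
    have h2 : ‖WithLp.toLp 2 (X n i)‖ ≤ ⨆ i : Fin n, ‖WithLp.toLp 2 (X n i)‖ :=
      le_ciSup (f := fun i : Fin n => ‖WithLp.toLp 2 (X n i)‖) (Set.finite_range _).bddAbove i
    have h3 := (h1.trans h2).trans (le_abs_self _)
    gcongr
  have hmem' : ∀ n i, MemLp (fun ω => a n i * ε n i ω) 4 P := fun n i => (hmem n i).const_mul _
  simp_rw [hsum]
  refine tendstoInDistribution_sum_of_lyapunov (ξ := fun n i ω => a n i * ε n i ω)
    (fun n => (hindep n).comp (fun i x => a n i * x) fun i => measurable_const_mul _) hmem'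
    (fun n i => by rw [integral_const_mul, hmean, mul_zero]) ?_ ?_
  · refine tendsto_const_nhds.congr' ?_
    filter_upwards [eventually_gt_atTop K] with n hn
    simp only [mul_pow, integral_const_mul, hvar, ← Finset.sum_mul, ha2 n hn]
    rw [inv_mul_cancel₀ (by positivity)]
  · have hlim := (((hD2.const_mul σ₀⁻¹).pow 2).mul_const (M * (σ₀ ^ 2)⁻¹))
    simp only [mul_zero, ne_eq, OfNat.ofNat_ne_zero, not_false_eq_true, zero_pow, zero_mul] at hlim
    refine tendsto_of_tendsto_of_tendsto_of_le_of_le' tendsto_const_nhds hlim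
      (.of_forall fun n => Finset.sum_nonneg fun i _ => integral_nonneg fun ω => by positivity) ?_
    filter_upwards [eventually_gt_atTop K] with n hn
    rw [← ha2 n hn, ← mul_assoc, Finset.mul_sum]
    refine Finset.sum_le_sum fun i _ => ?_
    simp only [mul_pow, integral_const_mul]
    have h0 : 0 ≤ ∫ ω, ε n i ω ^ 4 ∂P := integral_nonneg fun ω => by positivity
    have h1 := (hmax n i).trans_eq (mul_pow _ _ _)
    have hM : 0 ≤ M := h0.trans (hfourth n i)
    calc a n i ^ 4 * ∫ ω, ε n i ω ^ 4 ∂P = a n i ^ 2 * (∫ ω, ε n i ω ^ 4 ∂P) * a n i ^ 2 := by ring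
      _ ≤ _ := mul_le_mul_of_nonneg_right
        (mul_le_mul h1 (hfourth n i) h0 (by positivity)) (sq_nonneg _)

/-- Slutsky's theorem transfers the limit from the noise to `ξₖ`. -/
lemma tendstoInDistribution_xi (hσ₀ : 0 < σ₀) (hD2 : NegligibleCovariates X)
    (hX : OrthogonalDesign X) (hindep : ∀ n, iIndepFun (ε n) P)
    (hmem : ∀ n i, MemLp (ε n i) 4 P) (hmean : ∀ n i, ∫ ω, ε n i ω ∂P = 0)
    (hvar : ∀ n i, ∫ ω, ε n i ω ^ 2 ∂P = σ₀ ^ 2) (hfourth : ∀ n i, ∫ ω, ε n i ω ^ 4 ∂P ≤ M)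
    {k : Fin K} (hk : β₀ k = 0) :
    TendstoInDistribution (fun n ω => xi (X n) (response (X n) β₀ fun i => ε n i ω) k) atTop id
      (fun _ => P) (gaussianReal 0 1) := by
  have hYm : ∀ n i, AEMeasurable (fun ω => response (X n) β₀ (fun i => ε n i ω) i) P := fun n i =>
    (hmem n i).aestronglyMeasurable.aemeasurable.const_add _
  have hratio : TendstoInMeasure P
      (fun n ω => σ₀ * (sigmaHat (X n) (response (X n) β₀ fun i => ε n i ω))⁻¹) atTop
      fun _ => 1 := by
    have hc : ContinuousAt (fun x : ℝ => σ₀ * (√x)⁻¹) (σ₀ ^ 2) :=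
      continuousAt_const.mul (Real.continuous_sqrt.continuousAt.inv₀ (by positivity))
    have := tendstoInMeasure_comp_of_continuousAt hc
      (tendstoInMeasure_sq_sigmaHat (β₀ := β₀) hX hindep hmem hmean hvar hfourth)
    simpa [Real.sqrt_sq hσ₀.le, hσ₀.ne', Real.sqrt_sq (Real.sqrt_nonneg _), sigmaHat] using this
  have hprod := (tendstoInDistribution_scoreNoise hσ₀ hD2 hX hindep hmem hmean hvar hfourth
    k).continuous_comp_prodMk_of_tendstoInMeasure_const (g := fun p : ℝ × ℝ => p.1 * p.2)
    (by fun_prop) hratio (fun n => (aemeasurable_sigmaHat (hYm n)).inv.const_mul _)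
  refine tendstoInDistribution_of_tendstoInMeasure_sub _ _
    (by simpa [Function.id_def] using hprod) ?_
    fun n => aemeasurable_xi (hYm n) k
  rw [tendstoInMeasure_iff_norm]
  intro r hr
  refine tendsto_const_nhds.congr' ?_
  filter_upwards [eventually_gt_atTop K] with n hn
  have h0 : 0 < n := by omega
  symm
  convert measure_empty (μ := P)
  ext ω
  simp only [Set.mem_ofPred_eq, Set.mem_empty_iff_false, iff_false, not_le, Pi.sub_apply,
    Pi.zero_apply, sub_zero]
  rw [xi_response h0 (transpose_mul_self_of_orthogonal h0 (hX n hn)), hk]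
  refine lt_of_eq_of_lt (norm_eq_zero.2 ?_) hr
  field_simp
  ring

end Asymptotics

/-! ### The marginal likelihood of the hypervariances -/

section Likelihood

lemma lintegral_pi_prod {ι : Type*} [Fintype ι] {α : ι → Type*} [∀ i, MeasurableSpace (α i)]
    (μ : ∀ i, Measure (α i)) [∀ i, IsProbabilityMeasure (μ i)] {f : ∀ i, α i → ℝ≥0∞}
    (hf : ∀ i, Measurable (f i)) :
    ∫⁻ x, ∏ i, f i (x i) ∂Measure.pi μ = ∏ i, ∫⁻ a, f i a ∂μ i := by
  have h := lintegral_prod_eq_prod_lintegral_of_indepFun (μ := Measure.pi μ) Finset.univ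
    (fun i x => f i (x i)) (iIndepFun_pi (X := f) fun i => (hf i).aemeasurable)
    fun i => (hf i).comp (measurable_pi_apply i)
  rw [h]
  exact Finset.prod_congr rfl fun i _ => (measurePreserving_eval μ i).lintegral_comp (hf i)

/-- The marginal likelihood factor of a coefficient with statistic `z` and hypervariance `v`: the
integral of `exp (b z - b² / 2)` with respect to the law `N(0, v)` of `b`. -/
def marginalFactor (z v : ℝ) : ℝ := Real.exp (v / (2 * (1 + v)) * z ^ 2) * (√(1 + v))⁻¹

lemma marginalFactor_pos (z : ℝ) {v : ℝ} (hv : 0 ≤ v) : 0 < marginalFactor z v := by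
  unfold marginalFactor
  positivity

lemma lintegral_exp_gaussianReal (z : ℝ) (v : NNReal) :
    ∫⁻ b, ENNReal.ofReal (Real.exp (b * z - b ^ 2 / 2)) ∂gaussianReal 0 v =
      ENNReal.ofReal (marginalFactor z v) := by
  rcases eq_or_ne v 0 with rfl | hv
  · rw [gaussianReal_zero_var, lintegral_dirac]
    simp [marginalFactor]
  have hv0 : 0 < (v : ℝ) := NNReal.coe_pos.2 (pos_iff_ne_zero.2 hv)
  set s : NNReal := v / (1 + v) with hs
  have hs0 : s ≠ 0 := by rw [hs]; positivity
  have hsr : (s : ℝ) = v / (1 + v) := by simp [hs]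
  -- completing the square turns the integrand into a multiple of a normal density
  have key : ∀ b : ℝ, gaussianPDF 0 v b * ENNReal.ofReal (Real.exp (b * z - b ^ 2 / 2)) =
      ENNReal.ofReal (marginalFactor z v) * gaussianPDF (s * z) s b := by
    intro b
    rw [gaussianPDF, gaussianPDF, ← ENNReal.ofReal_mul (gaussianPDFReal_nonneg _ _ _),
      ← ENNReal.ofReal_mul (marginalFactor_pos z hv0.le).le]
    congr 1
    rw [gaussianPDFReal, gaussianPDFReal, marginalFactor, hsr]
    have h1 : √(2 * Real.pi * (v / (1 + v))) = √(2 * Real.pi * v) * (√(1 + v))⁻¹ := by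
      rw [← mul_div_assoc, Real.sqrt_div (by positivity), div_eq_mul_inv]
    have h2 : √(1 + (v : ℝ)) ≠ 0 := by positivity
    rw [h1, mul_inv, inv_inv]
    have h3 : Real.exp (-(b - 0) ^ 2 / (2 * v)) * Real.exp (b * z - b ^ 2 / 2) =
        Real.exp (v / (2 * (1 + v)) * z ^ 2) *
          Real.exp (-(b - v / (1 + v) * z) ^ 2 / (2 * (v / (1 + v)))) := by
      rw [← Real.exp_add, ← Real.exp_add]
      congr 1
      field_simp
      ring
    calc _ = (√(2 * Real.pi * v))⁻¹ *
          (Real.exp (-(b - 0) ^ 2 / (2 * v)) * Real.exp (b * z - b ^ 2 / 2)) := by ring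
      _ = _ := by rw [h3]; field_simp
  rw [gaussianReal_of_var_ne_zero _ hv,
    lintegral_withDensity_eq_lintegral_mul _ (measurable_gaussianPDF _ _) (by fun_prop)]
  simp only [Pi.mul_apply, key]
  rw [lintegral_const_mul _ (measurable_gaussianPDF _ _), lintegral_gaussianPDF_eq_one _ hs0,
    mul_one]

variable {n K : ℕ} {X : Matrix (Fin n) (Fin K) ℝ}

lemma dataDensity_eq (hn : 0 < n) (hX : Xᵀ * X = (n : ℝ) • (1 : Matrix (Fin K) (Fin K) ℝ))
    (y : Fin n → ℝ) (β : Fin K → ℝ) :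
    dataDensity X n y 1 β = (∏ i, gaussianPDF 0 (n : ℝ).toNNReal (y i)) *
      ∏ k, ENNReal.ofReal (Real.exp (β k * ((n : ℝ)⁻¹ * (Xᵀ *ᵥ y) k) - β k ^ 2 / 2)) := by
  have hn0 : (n : ℝ) ≠ 0 := by positivity
  have hshift : ∀ m x : ℝ, gaussianPDF m (n : ℝ).toNNReal x =
      gaussianPDF 0 (n : ℝ).toNNReal x *
        ENNReal.ofReal (Real.exp ((2 * (m * x) - m ^ 2) / (2 * n))) := by
    intro m x
    rw [gaussianPDF, gaussianPDF, ← ENNReal.ofReal_mul (gaussianPDFReal_nonneg _ _ _)]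
    congr 1
    rw [gaussianPDFReal, gaussianPDFReal, mul_assoc (√_)⁻¹, ← Real.exp_add]
    congr 2
    rw [Real.coe_toNNReal _ (Nat.cast_nonneg n)]
    field_simp
    ring
  rw [dataDensity, one_mul]
  rw [Finset.prod_congr rfl fun i _ => hshift ((X *ᵥ β) i) (y i), Finset.prod_mul_distrib]
  congr 1
  rw [← ENNReal.ofReal_prod_of_nonneg fun _ _ => (Real.exp_pos _).le,
    ← ENNReal.ofReal_prod_of_nonneg fun _ _ => (Real.exp_pos _).le, ← Real.exp_sum, ← Real.exp_sum,
    ← Finset.sum_div, Finset.sum_sub_distrib, Finset.sum_sub_distrib, ← Finset.mul_sum,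
    sum_mulVec_mul, sum_sq_mulVec hX, ← Finset.sum_div]
  congr 2
  have : ∑ k, β k * ((n : ℝ)⁻¹ * (Xᵀ *ᵥ y) k) = (n : ℝ)⁻¹ * ∑ k, β k * (Xᵀ *ᵥ y) k := by
    rw [Finset.mul_sum]
    exact Finset.sum_congr rfl fun k _ => by ring
  rw [this]
  field_simp

lemma eq_dirac_of_singleton {μ : Measure ℝ} [IsProbabilityMeasure μ] {a : ℝ} (h : μ {a} = 1) :
    μ = Measure.dirac a := by
  have hae : ∀ᵐ x ∂μ, x = a := (prob_compl_eq_zero_iff (measurableSet_singleton a)).2 h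
  have : μ.map (fun x => x) = μ.map fun _ => a := Measure.map_congr hae
  rwa [Measure.map_id', Measure.map_const, measure_univ, one_smul] at this

/-- Under an orthogonal design and a unit variance the likelihood of the hypervariances splits into
one factor for each coefficient. A nonpositive hypervariance counts as zero. -/
lemma exists_likelihood_eq (hn : 0 < n)
    (hX : Xᵀ * X = (n : ℝ) • (1 : Matrix (Fin K) (Fin K) ℝ)) {μ : Measure ℝ}
    [IsProbabilityMeasure μ] (hμ : μ {1} = 1) (Y : Fin n → ℝ) :
    ∃ C : ℝ≥0∞, C ≠ 0 ∧ C ≠ ∞ ∧ likelihood X n μ (rescaled X Y) = fun γ =>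
      C * ∏ k, ENNReal.ofReal (marginalFactor (xi X Y k) (γ k).toNNReal) := by
  have hn' : (n : ℝ).toNNReal ≠ 0 := by
    rw [ne_eq, Real.toNNReal_eq_zero, not_le]
    positivity
  refine ⟨∏ i, gaussianPDF 0 (n : ℝ).toNNReal (rescaled X Y i), ?_, ?_, ?_⟩
  · exact Finset.prod_ne_zero_iff.2 fun i _ => (gaussianPDF_pos _ hn' _).ne'
  · exact ENNReal.prod_ne_top fun i _ => gaussianPDF_ne_top
  · have hxi : ∀ k, (n : ℝ)⁻¹ * (Xᵀ *ᵥ rescaled X Y) k = xi X Y k := by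
      intro k
      have hs : (n : ℝ)⁻¹ * √(n : ℝ) = (√(n : ℝ))⁻¹ := by
        rw [← Real.sqrt_div_self, div_eq_inv_mul]
      have : (Xᵀ *ᵥ rescaled X Y) k = (sigmaHat X Y)⁻¹ * √(n : ℝ) * ∑ i, X i k * Y i := by
        simp only [Matrix.mulVec, dotProduct, Matrix.transpose_apply, rescaled, Finset.mul_sum]
        exact Finset.sum_congr rfl fun i _ => by ring
      rw [this, xi, ← hs]
      ring
    ext γ
    rw [likelihood, eq_dirac_of_singleton hμ, lintegral_dirac]
    simp only [dataDensity_eq hn hX, hxi]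
    rw [lintegral_const_mul _ (by fun_prop), betaGivenGamma,
      lintegral_pi_prod (f := fun k b => ENNReal.ofReal (Real.exp (b * xi X Y k - b ^ 2 / 2))) _
        fun k => by fun_prop]
    simp_rw [lintegral_exp_gaussianReal]

@[fun_prop]
lemma measurable_marginalFactor (z : ℝ) :
    Measurable fun v : ℝ => ENNReal.ofReal (marginalFactor z v.toNNReal) := by
  unfold marginalFactor
  fun_prop

lemma marginalFactor_le (z : ℝ) {v : ℝ} (hv : 0 ≤ v) :
    marginalFactor z v ≤ Real.exp (v / (1 + v) * (z ^ 2 / 2)) := by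
  have h1 : (√(1 + v))⁻¹ ≤ 1 := inv_le_one_of_one_le₀ (Real.one_le_sqrt.2 (by linarith))
  refine (mul_le_of_le_one_right (Real.exp_pos _).le h1).trans_eq ?_
  congr 1
  field_simp

lemma marginalFactor_le_exp (z : ℝ) {v : ℝ} (hv : 0 ≤ v) :
    marginalFactor z v ≤ Real.exp (z ^ 2 / 2) := by
  refine (marginalFactor_le z hv).trans (Real.exp_le_exp.2 ?_)
  have : v / (1 + v) ≤ 1 := (div_le_one (by linarith)).2 (by linarith)
  exact mul_le_of_le_one_left (by positivity) this

end Likelihood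

/-! ### Bayes' formula for product likelihoods and mixtures -/

section Bayes

variable {Θ : Type*} [MeasurableSpace Θ]

lemma lintegral_ne_zero_of_pos (ρ : Measure Θ) [IsProbabilityMeasure ρ] {f : Θ → ℝ≥0∞}
    (hf : Measurable f) (h : ∀ θ, 0 < f θ) : ∫⁻ θ, f θ ∂ρ ≠ 0 := by
  refine ((lintegral_pos_iff_support hf).2 ?_).ne'
  have : Function.support f = Set.univ := by
    ext θ
    simp [(h θ).ne']
  rw [this, measure_univ]
  exact one_pos

lemma bayes_const_mul (ρ : Measure Θ) {L : Θ → ℝ≥0∞} (hL : Measurable L) {C : ℝ≥0∞} (h0 : C ≠ 0)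
    (hC : C ≠ ∞) : bayes ρ (fun θ => C * L θ) = bayes ρ L := by
  have : (fun θ => C * L θ) = C • L := rfl
  rw [bayes, lintegral_const_mul _ hL, this, withDensity_smul _ hL, smul_smul,
    ENNReal.mul_inv (Or.inl h0) (Or.inl hC), mul_assoc, mul_comm _ C, ← mul_assoc,
    ENNReal.inv_mul_cancel h0 hC, one_mul, bayes]

lemma bayes_apply (ρ : Measure Θ) (L : Θ → ℝ≥0∞) {s : Set Θ} (hs : MeasurableSet s) :
    bayes ρ L s = (∫⁻ θ, L θ ∂ρ)⁻¹ * ∫⁻ θ in s, L θ ∂ρ := by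
  rw [bayes, Measure.smul_apply, smul_eq_mul, withDensity_apply _ hs]

lemma isProbabilityMeasure_bayes {ρ : Measure Θ} {L : Θ → ℝ≥0∞} (h0 : ∫⁻ θ, L θ ∂ρ ≠ 0)
    (hi : ∫⁻ θ, L θ ∂ρ ≠ ∞) : IsProbabilityMeasure (bayes ρ L) := by
  refine ⟨?_⟩
  rw [bayes_apply _ _ MeasurableSet.univ, Measure.restrict_univ, ENNReal.inv_mul_cancel h0 hi]

/-- With independent coordinates and a likelihood in product form, the coordinates can be updated
separately. -/
lemma map_eval_bayes_pi {ι : Type*} [Fintype ι] {α : ι → Type*} [∀ i, MeasurableSpace (α i)]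
    (ρ : ∀ i, Measure (α i)) [∀ i, IsProbabilityMeasure (ρ i)] {f : ∀ i, α i → ℝ≥0∞}
    (hf : ∀ i, Measurable (f i)) (h0 : ∀ i, ∫⁻ a, f i a ∂ρ i ≠ 0)
    (hi : ∀ i, ∫⁻ a, f i a ∂ρ i ≠ ∞) (k : ι) :
    (bayes (Measure.pi ρ) fun x => ∏ i, f i (x i)).map (fun x => x k) = bayes (ρ k) (f k) := by
  classical
  ext s hs
  have hm : Measurable fun x : ∀ i, α i => x k := measurable_pi_apply k
  set g : ∀ i, α i → ℝ≥0∞ := Function.update f k (s.indicator (f k)) with hg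
  have hgk : g k = s.indicator (f k) := Function.update_self ..
  have hgi : ∀ i, i ≠ k → g i = f i := fun i hik => Function.update_of_ne hik ..
  have hgm : ∀ i, Measurable (g i) := fun i => by
    rcases eq_or_ne i k with rfl | hik
    · rw [hgk]; exact (hf i).indicator hs
    · rw [hgi i hik]; exact hf i
  have hprod : ∀ x : ∀ i, α i, ((fun x : ∀ i, α i => x k) ⁻¹' s).indicator
      (fun x => ∏ i, f i (x i)) x = ∏ i, g i (x i) := by
    intro x
    rw [← Finset.mul_prod_erase Finset.univ _ (Finset.mem_univ k), hgk,
      Finset.prod_congr rfl fun i hi => by rw [hgi i (Finset.ne_of_mem_erase hi)]]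
    by_cases hx : x k ∈ s
    · rw [Set.indicator_of_mem (by exact hx), Set.indicator_of_mem hx,
        Finset.mul_prod_erase Finset.univ (fun i => f i (x i)) (Finset.mem_univ k)]
    · rw [Set.indicator_of_notMem (by exact hx), Set.indicator_of_notMem hx, zero_mul]
  rw [Measure.map_apply hm hs, bayes_apply _ _ (hm hs), bayes_apply _ _ hs,
    ← lintegral_indicator (hm hs)]
  simp_rw [hprod]
  rw [lintegral_pi_prod ρ hf, lintegral_pi_prod ρ hgm,
    ← Finset.mul_prod_erase Finset.univ _ (Finset.mem_univ k),
    ← Finset.mul_prod_erase Finset.univ (fun i => ∫⁻ a, g i a ∂ρ i) (Finset.mem_univ k), hgk,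
    lintegral_indicator hs,
    Finset.prod_congr (f := fun i => ∫⁻ a, g i a ∂ρ i) (g := fun i => ∫⁻ a, f i a ∂ρ i) rfl
      fun i hi => by rw [hgi i (Finset.ne_of_mem_erase hi)]]
  have hE0 : ∏ i ∈ Finset.univ.erase k, ∫⁻ a, f i a ∂ρ i ≠ 0 :=
    Finset.prod_ne_zero_iff.2 fun i _ => h0 i
  have hEi : ∏ i ∈ Finset.univ.erase k, ∫⁻ a, f i a ∂ρ i ≠ ∞ := ENNReal.prod_ne_top fun i _ => hi i
  rw [ENNReal.mul_inv (Or.inl (h0 k)) (Or.inl (hi k)), mul_assoc, mul_comm (∫⁻ a in s, f k a ∂ρ k),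
    ← mul_assoc _ _ (∫⁻ a in s, f k a ∂ρ k), ENNReal.inv_mul_cancel hE0 hEi, one_mul]

/-- Disintegration of a posterior: when the data depend on `(w, θ)` through `θ` only, the posterior
of `θ` under the conditional prior given `w` is the conditional law of `θ` given `w` under the joint
posterior. -/
lemma bayes_bind_prod {α : Type*} [MeasurableSpace α] (ρ : Measure α) [IsProbabilityMeasure ρ]
    {κ : α → Measure Θ} (hκ : Measurable κ) [∀ w, IsProbabilityMeasure (κ w)] {L : Θ → ℝ≥0∞}
    (hL : Measurable L) (h0 : ∀ w, ∫⁻ θ, L θ ∂κ w ≠ 0) (hi : ∀ w, ∫⁻ θ, L θ ∂κ w ≠ ∞)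
    {A : Set α} {B : Set Θ} (hA : MeasurableSet A) (hB : MeasurableSet B) :
    bayes (ρ.bind fun w => (κ w).map (Prod.mk w)) (fun p => L p.2) (A ×ˢ B) =
      ∫⁻ w in A, bayes (κ w) L B
        ∂((bayes (ρ.bind fun w => (κ w).map (Prod.mk w)) (fun p => L p.2)).map Prod.fst) := by
  let κ' : Kernel α Θ := ⟨κ, hκ⟩
  have : IsMarkovKernel κ' := ⟨fun w => inferInstanceAs (IsProbabilityMeasure (κ w))⟩
  have hJ : ρ.bind (fun w => (κ w).map (Prod.mk w)) = ρ ⊗ₘ κ' := by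
    have hmap : ∀ s : Set (α × Θ), MeasurableSet s → ∀ w,
        (κ w).map (Prod.mk w) s = κ' w (Prod.mk w ⁻¹' s) := fun s hs w =>
      Measure.map_apply measurable_prodMk_left hs
    have hmeas : Measurable fun w => (κ w).map (Prod.mk w) := by
      refine Measure.measurable_of_measurable_coe _ fun s hs => ?_
      simp_rw [hmap s hs]
      exact Kernel.measurable_kernel_prodMk_left hs
    ext s hs
    rw [Measure.bind_apply hs hmeas.aemeasurable, Measure.compProd_apply hs]
    simp_rw [hmap s hs]
  rw [hJ]
  set J := ρ ⊗ₘ κ'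
  set Z := ∫⁻ p, L p.2 ∂J
  have hL2 : Measurable fun p : α × Θ => L p.2 := hL.comp measurable_snd
  have hrect : ∀ (A : Set α) (B : Set Θ), MeasurableSet A → MeasurableSet B →
      bayes J (fun p => L p.2) (A ×ˢ B) = Z⁻¹ * ∫⁻ w in A, ∫⁻ θ in B, L θ ∂κ w ∂ρ := by
    intro A B hA hB
    rw [bayes_apply _ _ (hA.prod hB), ← lintegral_indicator (hA.prod hB),
      Measure.lintegral_compProd (hL2.indicator (hA.prod hB)), ← lintegral_indicator hA]
    congr 2
    ext w
    by_cases hw : w ∈ A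
    · rw [Set.indicator_of_mem hw, ← lintegral_indicator hB]
      refine lintegral_congr fun θ => ?_
      by_cases hθ : θ ∈ B
      · rw [Set.indicator_of_mem hθ, Set.indicator_of_mem (Set.mk_mem_prod hw hθ)]
      · rw [Set.indicator_of_notMem hθ, Set.indicator_of_notMem fun h => hθ h.2]
    · rw [Set.indicator_of_notMem hw]
      simp [Set.indicator, hw]
  have hmL : ∀ B, MeasurableSet B → Measurable fun w => ∫⁻ θ in B, L θ ∂κ w := by
    intro B hB
    simp_rw [← lintegral_indicator hB]
    exact (Measure.measurable_lintegral (hL.indicator hB)).comp hκ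
  have hmLbar : Measurable fun w => ∫⁻ θ, L θ ∂κ w := (Measure.measurable_lintegral hL).comp hκ
  have hfst : (bayes J (fun p => L p.2)).map Prod.fst =
      Z⁻¹ • ρ.withDensity fun w => ∫⁻ θ, L θ ∂κ w := by
    ext s hs
    rw [Measure.map_apply measurable_fst hs, ← Set.prod_univ, hrect s _ hs MeasurableSet.univ,
      Measure.smul_apply, withDensity_apply _ hs, smul_eq_mul]
    simp
  rw [hrect A B hA hB, hfst, Measure.restrict_smul, lintegral_smul_measure, smul_eq_mul,
    restrict_withDensity hA]
  congr 1
  have hbm : Measurable fun w => bayes (κ w) L B := by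
    simp_rw [bayes_apply _ _ hB]
    exact hmLbar.inv.mul (hmL B hB)
  rw [lintegral_withDensity_eq_lintegral_mul _ hmLbar hbm]
  refine lintegral_congr fun w => ?_
  rw [Pi.mul_apply, bayes_apply _ _ hB, ← mul_assoc, ENNReal.mul_inv_cancel (h0 w) (hi w), one_mul]

end Bayes

/-! ### The posterior mass of the spike region -/

section ProductLikelihood

variable {K : ℕ}

/-- The likelihood of the hypervariances up to a constant: the product of the marginal likelihood
factors. -/
def productLikelihood (z : Fin K → ℝ) (γ : Fin K → ℝ) : ℝ≥0∞ :=
  ∏ k, ENNReal.ofReal (marginalFactor (z k) (γ k).toNNReal)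

@[fun_prop]
lemma measurable_productLikelihood (z : Fin K → ℝ) : Measurable (productLikelihood z) := by
  unfold productLikelihood
  exact Finset.measurable_fun_prod _ fun k _ =>
    (measurable_marginalFactor (z k)).comp (measurable_pi_apply k)

lemma ofReal_marginalFactor_pos (z v : ℝ) : 0 < ENNReal.ofReal (marginalFactor z v.toNNReal) :=
  ENNReal.ofReal_pos.2 (marginalFactor_pos z v.toNNReal.coe_nonneg)

lemma productLikelihood_pos (z γ : Fin K → ℝ) : 0 < productLikelihood z γ :=
  pos_iff_ne_zero.2 (Finset.prod_ne_zero_iff.2 fun _ _ => (ofReal_marginalFactor_pos _ _).ne')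

lemma lintegral_marginalFactor_ne_top (ρ : Measure ℝ) [IsProbabilityMeasure ρ] (z : ℝ) :
    ∫⁻ v, ENNReal.ofReal (marginalFactor z v.toNNReal) ∂ρ ≠ ∞ := by
  refine ne_top_of_le_ne_top (ENNReal.ofReal_ne_top (r := Real.exp (z ^ 2 / 2)))
    ((lintegral_mono fun v => ENNReal.ofReal_le_ofReal
      (marginalFactor_le_exp z v.toNNReal.coe_nonneg)).trans_eq ?_)
  rw [lintegral_const, measure_univ, mul_one]

lemma lintegral_productLikelihood_ne_top (ρ : Measure (Fin K → ℝ)) [IsProbabilityMeasure ρ]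
    (z : Fin K → ℝ) : ∫⁻ γ, productLikelihood z γ ∂ρ ≠ ∞ := by
  refine ne_top_of_le_ne_top (b := ∏ k, ENNReal.ofReal (Real.exp (z k ^ 2 / 2)))
    (ENNReal.prod_ne_top fun k _ => ENNReal.ofReal_ne_top)
    ((lintegral_mono fun γ => Finset.prod_le_prod' fun k _ => ENNReal.ofReal_le_ofReal
      (marginalFactor_le_exp (z k) (γ k).toNNReal.coe_nonneg)).trans_eq ?_)
  rw [lintegral_const, measure_univ, mul_one]

lemma lintegral_productLikelihood_ne_zero (ρ : Measure (Fin K → ℝ)) [IsProbabilityMeasure ρ]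
    (z : Fin K → ℝ) : ∫⁻ γ, productLikelihood z γ ∂ρ ≠ 0 :=
  lintegral_ne_zero_of_pos ρ (measurable_productLikelihood z) (productLikelihood_pos z)

lemma bayes_likelihood {n : ℕ} {X : Matrix (Fin n) (Fin K) ℝ} (hn : 0 < n)
    (hX : Xᵀ * X = (n : ℝ) • (1 : Matrix (Fin K) (Fin K) ℝ)) {μ : Measure ℝ}
    [IsProbabilityMeasure μ] (hμ : μ {1} = 1) (Y : Fin n → ℝ) {Θ : Type*} [MeasurableSpace Θ]
    (ρ : Measure Θ) {g : Θ → Fin K → ℝ} (hg : Measurable g) :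
    bayes ρ (fun θ => likelihood X n μ (rescaled X Y) (g θ)) =
      bayes ρ fun θ => productLikelihood (xi X Y) (g θ) := by
  obtain ⟨C, h0, hC, hL⟩ := exists_likelihood_eq hn hX hμ Y
  rw [hL]
  exact bayes_const_mul ρ ((measurable_productLikelihood _).comp hg) h0 hC

/-- The key estimate: the likelihood ratio of the spike region `γₖ / (1 + γₖ) ≤ 1 - δ` to a cube in
the slab region. On the spike region the factor of `γₖ` is smaller by `exp (-δ zₖ² / 2)` than its
supremum, whereas on the cube every factor is within `exp (zⱼ² / (2 (1 + T)))` of its supremum, up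
to a constant. -/
lemma bayes_productLikelihood_spike_le (π : Measure (Fin K → ℝ)) [IsProbabilityMeasure π]
    (hpos : ∀ k, π {γ | 0 < γ k} = 1) {T : ℝ} (hT : 0 ≤ T)
    (hB : π (Set.univ.pi fun _ => Set.Ioo T (T + 1)) ≠ 0) (z : Fin K → ℝ) (k : Fin K) (δ : ℝ) :
    bayes π (productLikelihood z) {γ | 1 - δ < γ k / (1 + γ k)}ᶜ ≤
      (π (Set.univ.pi fun _ => Set.Ioo T (T + 1)))⁻¹ * ENNReal.ofReal
        (Real.exp ((1 + T)⁻¹ * ∑ j, z j ^ 2 / 2 - δ * (z k ^ 2 / 2)) * √(2 + T) ^ K) := by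
  set S : Set (Fin K → ℝ) := {γ | 1 - δ < γ k / (1 + γ k)}
  set B : Set (Fin K → ℝ) := Set.univ.pi fun _ => Set.Ioo T (T + 1)
  have hS : MeasurableSet S := measurableSet_lt (by fun_prop) (by fun_prop)
  have hBm : MeasurableSet B := MeasurableSet.univ_pi fun _ => measurableSet_Ioo
  have hae : ∀ᵐ γ ∂π, ∀ j, 0 < γ j := ae_all_iff.2 fun j =>
    (prob_compl_eq_zero_iff (measurableSet_lt measurable_const (measurable_pi_apply j))).2 (hpos j)
  have hnonneg : ∀ (γ : Fin K → ℝ) j, 0 ≤ marginalFactor (z j) (γ j).toNNReal := fun γ j =>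
    (marginalFactor_pos (z j) (γ j).toNNReal.coe_nonneg).le
  have hprod : ∀ γ : Fin K → ℝ, productLikelihood z γ =
      ENNReal.ofReal (∏ j, marginalFactor (z j) (γ j).toNNReal) := fun γ =>
    (ENNReal.ofReal_prod_of_nonneg fun j _ => hnonneg γ j).symm
  set Q := ∑ j, z j ^ 2 / 2 with hQ
  have hnum : ∫⁻ γ in Sᶜ, productLikelihood z γ ∂π ≤
      ENNReal.ofReal (Real.exp (Q - δ * (z k ^ 2 / 2))) := by
    have hle : ∀ᵐ γ ∂π.restrict Sᶜ, productLikelihood z γ ≤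
        ENNReal.ofReal (Real.exp (Q - δ * (z k ^ 2 / 2))) := by
      filter_upwards [ae_restrict_of_ae hae, ae_restrict_mem hS.compl] with γ hγ hγS
      rw [hprod]
      refine ENNReal.ofReal_le_ofReal ?_
      have hγk : γ k / (1 + γ k) ≤ 1 - δ := not_lt.1 hγS
      refine (Finset.prod_le_prod (fun j _ => hnonneg γ j)
        fun j _ => marginalFactor_le (z j) (γ j).toNNReal.coe_nonneg).trans ?_
      rw [← Real.exp_sum]
      refine Real.exp_le_exp.2 ?_
      rw [hQ, ← Finset.add_sum_erase Finset.univ _ (Finset.mem_univ k),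
        ← Finset.add_sum_erase Finset.univ (fun j => z j ^ 2 / 2) (Finset.mem_univ k)]
      have h1 : ∑ j ∈ Finset.univ.erase k, ((γ j).toNNReal : ℝ) / (1 + (γ j).toNNReal) *
          (z j ^ 2 / 2) ≤ ∑ j ∈ Finset.univ.erase k, z j ^ 2 / 2 :=
        Finset.sum_le_sum fun j _ => mul_le_of_le_one_left (by positivity)
          ((div_le_one (by positivity)).2 (by linarith))
      have h2 : ((γ k).toNNReal : ℝ) / (1 + (γ k).toNNReal) * (z k ^ 2 / 2) ≤
          (1 - δ) * (z k ^ 2 / 2) := by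
        rw [Real.coe_toNNReal _ (hγ k).le]
        exact mul_le_mul_of_nonneg_right hγk (by positivity)
      linarith
    refine (lintegral_mono_ae hle).trans ?_
    rw [lintegral_const, Measure.restrict_apply_univ]
    exact mul_le_of_le_one_right zero_le prob_le_one
  have hden : π B * ENNReal.ofReal (Real.exp (T / (1 + T) * Q) * (√(2 + T) ^ K)⁻¹) ≤
      ∫⁻ γ, productLikelihood z γ ∂π := by
    have hle : ∀ γ ∈ B, ENNReal.ofReal (Real.exp (T / (1 + T) * Q) * (√(2 + T) ^ K)⁻¹) ≤
        productLikelihood z γ := by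
      intro γ hγ
      rw [hprod]
      refine ENNReal.ofReal_le_ofReal ?_
      have hc : Real.exp (T / (1 + T) * Q) * (√(2 + T) ^ K)⁻¹ =
          ∏ j, Real.exp (T / (1 + T) * (z j ^ 2 / 2)) * (√(2 + T))⁻¹ := by
        rw [Finset.prod_mul_distrib, ← Real.exp_sum, ← Finset.mul_sum, ← hQ]
        simp
      rw [hc]
      refine Finset.prod_le_prod (fun j _ => by positivity) fun j _ => ?_
      obtain ⟨hj1, hj2⟩ := hγ j (Set.mem_univ j)
      have hj0 : 0 < γ j := by linarith
      rw [Real.coe_toNNReal _ hj0.le, marginalFactor]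
      have h1 : T / (1 + T) ≤ γ j / (1 + γ j) := by
        rw [div_le_div_iff₀ (by linarith) (by linarith)]
        nlinarith
      have h2 : √(1 + γ j) ≤ √(2 + T) := Real.sqrt_le_sqrt (by linarith)
      have h3 : γ j / (2 * (1 + γ j)) * z j ^ 2 = γ j / (1 + γ j) * (z j ^ 2 / 2) := by
        field_simp
      rw [h3]
      have h4 : 0 < √(1 + γ j) := Real.sqrt_pos.2 (by linarith)
      gcongr
    calc _ = ∫⁻ _ in B, ENNReal.ofReal (Real.exp (T / (1 + T) * Q) * (√(2 + T) ^ K)⁻¹) ∂π := by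
          rw [lintegral_const, Measure.restrict_apply_univ, mul_comm]
      _ ≤ ∫⁻ γ in B, productLikelihood z γ ∂π := setLIntegral_mono' hBm hle
      _ ≤ _ := setLIntegral_le_lintegral _ _
  rw [bayes_apply _ _ hS.compl]
  refine (mul_le_mul' (ENNReal.inv_le_inv.2 hden) hnum).trans_eq ?_
  have hq : 0 < √(2 + T) := Real.sqrt_pos.2 (by linarith)
  rw [ENNReal.mul_inv (Or.inl hB) (Or.inl (measure_ne_top _ _)), mul_assoc,
    ← ENNReal.ofReal_inv_of_pos (by positivity), ← ENNReal.ofReal_mul (by positivity)]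
  congr 2
  have hT1 : T / (1 + T) = 1 - (1 + T)⁻¹ := by
    have : 1 + T ≠ 0 := by linarith
    field_simp
    ring
  rw [mul_inv, inv_inv, ← Real.exp_neg, mul_right_comm, ← Real.exp_add, hT1]
  congr 2
  ring

end ProductLikelihood

/-! ### The bimodal prior -/

section Bimodal

variable {v₀ a₁ a₂ : ℝ}

lemma gDensity_nonneg (h₁ : 0 < a₁) (h₂ : 0 < a₂) {u : ℝ} (hu : 0 < u) : 0 ≤ gDensity a₁ a₂ u := by
  have := Real.Gamma_pos_of_pos h₁
  unfold gDensity
  positivity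

/-- The scaled inverse gamma law, by the change of variables `u = c / t`. -/
lemma map_mul_inv_gammaMeasure {c : ℝ} (hc : 0 < c) :
    (gammaMeasure a₁ a₂).map (fun t => c * t⁻¹) = (volume.restrict (Set.Ioi 0)).withDensity
      fun u => ENNReal.ofReal (c * (u ^ 2)⁻¹ * gDensity a₁ a₂ (c * u⁻¹)) := by
  have hm : Measurable fun t : ℝ => c * t⁻¹ := by fun_prop
  ext s hs
  rw [Measure.map_apply hm hs, withDensity_apply _ hs, Measure.restrict_restrict hs, gammaMeasure,
    withDensity_apply _ (hm hs), ← lintegral_indicator (hm hs)]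
  have hinv : ∀ u : ℝ, c * (c * u⁻¹)⁻¹ = u := fun u => by
    rw [mul_inv, inv_inv, mul_inv_cancel_left₀ hc.ne']
  have himage : (fun u : ℝ => c * u⁻¹) '' (s ∩ Set.Ioi 0) =
      (fun t : ℝ => c * t⁻¹) ⁻¹' s ∩ Set.Ioi 0 := by
    ext t
    constructor
    · rintro ⟨u, ⟨hus, hu⟩, rfl⟩
      have hu' : 0 < u := hu
      refine ⟨?_, Set.mem_Ioi.2 (by positivity)⟩
      simpa only [Set.mem_preimage, hinv] using hus
    · rintro ⟨hts, ht⟩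
      have ht' : 0 < t := ht
      exact ⟨c * t⁻¹, ⟨hts, Set.mem_Ioi.2 (by positivity)⟩, hinv t⟩
  have hcv := lintegral_image_eq_lintegral_abs_deriv_mul (s := s ∩ Set.Ioi 0)
    (f := fun u : ℝ => c * u⁻¹) (f' := fun u => c * -(u ^ 2)⁻¹) (hs.inter measurableSet_Ioi)
    (fun u hu => ((hasDerivAt_inv (ne_of_gt hu.2)).const_mul c).hasDerivWithinAt)
    (fun u _ v _ huv => by
      have := congrArg (fun x => c * x⁻¹) huv
      simpa only [hinv] using this)
    (fun t => ENNReal.ofReal (gDensity a₁ a₂ t))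
  rw [himage] at hcv
  have hleft : ∫⁻ t, ((fun t : ℝ => c * t⁻¹) ⁻¹' s).indicator (gammaPDF a₁ a₂) t =
      ∫⁻ t in (fun t : ℝ => c * t⁻¹) ⁻¹' s ∩ Set.Ioi 0, ENNReal.ofReal (gDensity a₁ a₂ t) := by
    rw [← lintegral_indicator ((hm hs).inter measurableSet_Ioi)]
    refine lintegral_congr_ae ?_
    filter_upwards [Measure.ae_ne volume (0 : ℝ)] with t ht
    rcases lt_or_gt_of_ne ht with h | h
    · rw [Set.indicator_of_notMem (s := _ ∩ Set.Ioi 0) fun hmem => not_lt.2 h.le hmem.2]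
      simp [Set.indicator, gammaPDF_of_neg h]
    · by_cases hts : t ∈ (fun t : ℝ => c * t⁻¹) ⁻¹' s
      · rw [Set.indicator_of_mem hts, Set.indicator_of_mem (Set.mem_inter hts (Set.mem_Ioi.2 h)),
          gammaPDF_of_nonneg h.le, gDensity]
      · rw [Set.indicator_of_notMem hts,
          Set.indicator_of_notMem (s := _ ∩ Set.Ioi 0) fun hmem => hts hmem.1]
  rw [hleft, hcv]
  refine setLIntegral_congr_fun (hs.inter measurableSet_Ioi) fun u hu => ?_
  have hu' : 0 < u := hu.2
  rw [mul_neg, abs_neg, abs_of_pos (by positivity), ← ENNReal.ofReal_mul (by positivity)]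

lemma hypervarianceLaw_eq_withDensity (hv₀ : 0 < v₀) (h₁ : 0 < a₁) (h₂ : 0 < a₂)
    (w : unitInterval) :
    hypervarianceLaw v₀ a₁ a₂ w = (volume.restrict (Set.Ioi 0)).withDensity fun u =>
      ENNReal.ofReal ((1 - (w : ℝ)) * g₀ v₀ a₁ a₂ u + w * g₁ a₁ a₂ u) := by
  have := isProbabilityMeasure_gammaMeasure h₁ h₂
  have hm : Measurable fun p : ℝ × ℝ => p.1 * p.2⁻¹ := by fun_prop
  have hdirac : ∀ c : ℝ, 0 < c → ((Measure.dirac c).prod (gammaMeasure a₁ a₂)).map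
      (fun p : ℝ × ℝ => p.1 * p.2⁻¹) = (volume.restrict (Set.Ioi 0)).withDensity
        fun u => ENNReal.ofReal (c * (u ^ 2)⁻¹ * gDensity a₁ a₂ (c * u⁻¹)) := fun c hc => by
    rw [Measure.dirac_prod, Measure.map_map hm measurable_prodMk_left,
      ← map_mul_inv_gammaMeasure hc]
    rfl
  have hw0 : 0 ≤ (w : ℝ) := w.2.1
  have hw1 : 0 ≤ 1 - (w : ℝ) := sub_nonneg.2 w.2.2
  rw [hypervarianceLaw, indicatorLaw, Measure.add_prod, Measure.prod_smul_left,
    Measure.prod_smul_left, Measure.map_add _ _ hm, Measure.map_smul, Measure.map_smul,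
    hdirac v₀ hv₀, hdirac 1 one_pos]
  have hmd : ∀ c : ℝ, Measurable fun u : ℝ =>
      ENNReal.ofReal (c * (u ^ 2)⁻¹ * gDensity a₁ a₂ (c * u⁻¹)) := fun c => by
    unfold gDensity
    fun_prop
  rw [← withDensity_smul _ (hmd _), ← withDensity_smul _ (hmd _),
    ← withDensity_add_left ((hmd _).const_smul _)]
  refine withDensity_congr_ae ?_
  filter_upwards [ae_restrict_mem measurableSet_Ioi] with u hu
  have hu' : 0 < u := hu
  have hg₀ : 0 ≤ g₀ v₀ a₁ a₂ u := by
    have := gDensity_nonneg h₁ h₂ (u := v₀ * u⁻¹) (by positivity)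
    unfold g₀
    positivity
  have hg₁ : 0 ≤ g₁ a₁ a₂ u := by
    have := gDensity_nonneg h₁ h₂ (u := u⁻¹) (by positivity)
    unfold g₁
    positivity
  rw [ENNReal.ofReal_add (by positivity) (by positivity), ENNReal.ofReal_mul hw1,
    ENNReal.ofReal_mul hw0]
  simp [g₀, g₁]

/-- The posterior law of a single hypervariance under the bimodal prior given `w`. -/
lemma exists_bayes_hypervarianceLaw_eq (hv₀ : 0 < v₀) (h₁ : 0 < a₁) (h₂ : 0 < a₂)
    (w : unitInterval) (z : ℝ) :
    ∃ c : ℝ, 0 < c ∧ bayes (hypervarianceLaw v₀ a₁ a₂ w)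
        (fun v => ENNReal.ofReal (marginalFactor z v.toNNReal)) =
      (volume.restrict (Set.Ioi 0)).withDensity fun u =>
        ENNReal.ofReal (c * posteriorShape v₀ a₁ a₂ z w u) := by
  have := isProbabilityMeasure_hypervarianceLaw v₀ h₁ h₂ w
  have h0 := lintegral_ne_zero_of_pos (hypervarianceLaw v₀ a₁ a₂ w)
    (measurable_marginalFactor z) (ofReal_marginalFactor_pos z)
  have hi := lintegral_marginalFactor_ne_top (hypervarianceLaw v₀ a₁ a₂ w) z
  rw [bayes]
  set Z := ∫⁻ v, ENNReal.ofReal (marginalFactor z v.toNNReal) ∂hypervarianceLaw v₀ a₁ a₂ w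
  have hZ : 0 < Z.toReal := ENNReal.toReal_pos h0 hi
  refine ⟨Z.toReal⁻¹, inv_pos.2 hZ, ?_⟩
  have hmd : Measurable fun u : ℝ =>
      ENNReal.ofReal ((1 - (w : ℝ)) * g₀ v₀ a₁ a₂ u + w * g₁ a₁ a₂ u) := by
    unfold g₀ g₁ gDensity
    fun_prop
  rw [hypervarianceLaw_eq_withDensity hv₀ h₁ h₂, ← withDensity_mul _ hmd
    (measurable_marginalFactor z), ← withDensity_smul _ (hmd.mul (measurable_marginalFactor z))]
  refine withDensity_congr_ae ?_
  filter_upwards [ae_restrict_mem measurableSet_Ioi] with u hu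
  have hu' : 0 < u := hu
  rw [ENNReal.ofReal_mul (inv_nonneg.2 hZ.le), ENNReal.ofReal_inv_of_pos hZ,
    ENNReal.ofReal_toReal hi, Pi.smul_apply, smul_eq_mul, Pi.mul_apply,
    Real.coe_toNNReal _ hu'.le, mul_comm (ENNReal.ofReal _),
    ← ENNReal.ofReal_mul (marginalFactor_pos z hu'.le).le]
  rfl

end Bimodal

/-! ### Posterior consistency -/

section Selection

variable {Ω : Type*} [MeasurableSpace Ω] {P : Measure Ω} [IsProbabilityMeasure P] {K : ℕ}
  {X : (n : ℕ) → Matrix (Fin n) (Fin K) ℝ} {ε : (n : ℕ) → Fin n → Ω → ℝ} {σ₀ M : ℝ}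
  {β₀ : Fin K → ℝ}

/-- The exponent in `bayes_productLikelihood_spike_le` is at most a negative multiple of `n`, once
the estimates `b + d` of the coefficients `b` have errors `d` at most `|b k| / 2`, the estimated
standard deviation `s` satisfies `s² ≤ 2 σ₀²`, and `T` is large. -/
lemma spike_exponent_le {n s δ η : ℝ} (hn : 0 ≤ n) (hs : 0 < s) (hsσ : s ^ 2 ≤ 2 * σ₀ ^ 2)
    (hδ : 0 < δ)
    {b d : Fin K → ℝ} {k : Fin K} (hη : η = |b k| / 2) (hb : b k ≠ 0) (hd : ∀ j, |d j| ≤ η)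
    {T : ℝ} (hT : 0 ≤ T) (hTA : 8 * ∑ j, (|b j| + η) ^ 2 ≤ δ * b k ^ 2 * (1 + T)) :
    (1 + T)⁻¹ * ∑ j, (s⁻¹ * (√n * (b j + d j))) ^ 2 / 2 -
        δ * ((s⁻¹ * (√n * (b k + d k))) ^ 2 / 2) ≤ -(δ * b k ^ 2 / (32 * σ₀ ^ 2)) * n := by
  have hz : ∀ j, (s⁻¹ * (√n * (b j + d j))) ^ 2 / 2 = n / (2 * s ^ 2) * (b j + d j) ^ 2 := by
    intro j
    rw [mul_pow, mul_pow, Real.sq_sqrt hn]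
    field_simp
  simp only [hz, ← Finset.mul_sum]
  have h1 : ∑ j, (b j + d j) ^ 2 ≤ ∑ j, (|b j| + η) ^ 2 := by
    refine Finset.sum_le_sum fun j _ => ?_
    rw [← sq_abs (b j + d j)]
    have := (abs_add_le (b j) (d j)).trans (add_le_add_right (hd j) _)
    gcongr
  have h2 : b k ^ 2 / 4 ≤ (b k + d k) ^ 2 := by
    have h3 : |b k| / 2 ≤ |b k + d k| := by
      have := abs_sub_abs_le_abs_sub (b k) (-d k)
      rw [abs_neg, sub_neg_eq_add] at this
      have := hd k
      linarith
    have h4 : (|b k| / 2) ^ 2 ≤ |b k + d k| ^ 2 := by gcongr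
    rw [sq_abs, div_pow, sq_abs] at h4
    linarith
  have hb2 : 0 < b k ^ 2 := by positivity
  have h5 : (1 + T)⁻¹ * ∑ j, (b j + d j) ^ 2 ≤ δ * b k ^ 2 / 8 := by
    rw [inv_mul_le_iff₀ (by linarith)]
    linarith
  have h6 : (1 + T)⁻¹ * ∑ j, (b j + d j) ^ 2 - δ * (b k + d k) ^ 2 ≤ -(δ * b k ^ 2 / 8) := by
    have := mul_le_mul_of_nonneg_left h2 hδ.le
    linarith
  have h7 : n / (4 * σ₀ ^ 2) ≤ n / (2 * s ^ 2) := by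
    gcongr n / ?_
    linarith
  have h8 : 0 ≤ n / (2 * s ^ 2) := by positivity
  have hσ : 0 < σ₀ ^ 2 := by nlinarith [sq_pos_of_pos hs]
  calc (1 + T)⁻¹ * (n / (2 * s ^ 2) * ∑ j, (b j + d j) ^ 2) -
        δ * (n / (2 * s ^ 2) * (b k + d k) ^ 2)
      = n / (2 * s ^ 2) * ((1 + T)⁻¹ * ∑ j, (b j + d j) ^ 2 - δ * (b k + d k) ^ 2) := by ring
    _ ≤ n / (2 * s ^ 2) * -(δ * b k ^ 2 / 8) := mul_le_mul_of_nonneg_left h6 h8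
    _ ≤ n / (4 * σ₀ ^ 2) * -(δ * b k ^ 2 / 8) :=
        mul_le_mul_of_nonpos_right h7 (by rw [neg_nonpos]; positivity)
    _ = _ := by field_simp; ring

/-- Posterior consistency for the hypervariances of the nonzero coefficients. -/
lemma tendstoInMeasure_bayes_slab (hσ₀ : 0 < σ₀)
    (hX : OrthogonalDesign X) (hindep : ∀ n, iIndepFun (ε n) P)
    (hmem : ∀ n i, MemLp (ε n i) 4 P) (hmean : ∀ n i, ∫ ω, ε n i ω ∂P = 0)
    (hvar : ∀ n i, ∫ ω, ε n i ω ^ 2 ∂P = σ₀ ^ 2) (hfourth : ∀ n i, ∫ ω, ε n i ω ^ 4 ∂P ≤ M)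
    {μ : Measure ℝ} [IsProbabilityMeasure μ] (hμ : μ {1} = 1)
    (π : Measure (Fin K → ℝ)) [IsProbabilityMeasure π] (hpos : ∀ k, π {γ | 0 < γ k} = 1)
    {η₀ : ℝ} (hη₀ : 0 ≤ η₀) (hsupp : (Set.univ.pi fun _ => Set.Ici η₀) ⊆ π.support)
    {δ : ℝ} (hδ : 0 < δ) {k : Fin K} (hk : β₀ k ≠ 0) :
    TendstoInMeasure P
      (fun n ω => (bayes π (likelihood (X n) n μ
        (rescaled (X n) (response (X n) β₀ fun i => ε n i ω)))).real
          {γ | 1 - δ < γ k / (1 + γ k)}) atTop fun _ => 1 := by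
  set η := |β₀ k| / 2 with hη
  have hη_pos : 0 < η := by positivity
  set A := ∑ j, (|β₀ j| + η) ^ 2 with hA
  have hA0 : 0 ≤ A := Finset.sum_nonneg fun j _ => sq_nonneg _
  have hb2 : 0 < β₀ k ^ 2 := by positivity
  -- the corner `T` of the cube is chosen far out, so that the loss on the cube is absorbed
  set T := η₀ + 8 * A / (δ * β₀ k ^ 2) with hTdef
  have hTη : η₀ ≤ T := le_add_of_nonneg_right (by positivity)
  have hT : 0 ≤ T := hη₀.trans hTη
  have hTA : 8 * A ≤ δ * β₀ k ^ 2 * (1 + T) := by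
    have : δ * β₀ k ^ 2 * (1 + T) = δ * β₀ k ^ 2 * (1 + η₀) + 8 * A := by
      rw [hTdef]; field_simp; ring
    rw [this]
    have : 0 ≤ δ * β₀ k ^ 2 * (1 + η₀) := by positivity
    linarith
  have hB : π (Set.univ.pi fun _ => Set.Ioo T (T + 1)) ≠ 0 := by
    have hc : (fun _ => T + 1 / 2 : Fin K → ℝ) ∈ π.support :=
      hsupp fun j _ => Set.mem_Ici.2 (by linarith)
    have ho : (Set.univ.pi fun _ : Fin K => Set.Ioo T (T + 1)) ∈
        𝓝 (fun _ => T + 1 / 2 : Fin K → ℝ) :=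
      (isOpen_set_pi Set.finite_univ fun _ _ => isOpen_Ioo).mem_nhds fun j _ =>
        ⟨by linarith, by linarith⟩
    exact ((Measure.mem_support_iff_forall _).1 hc _ ho).ne'
  set q := (π (Set.univ.pi fun _ : Fin K => Set.Ioo T (T + 1)))⁻¹.toReal * √(2 + T) ^ K with hq
  set c := δ * β₀ k ^ 2 / (32 * σ₀ ^ 2) with hcdef
  have hc : 0 < c := by positivity
  have hmem2 : ∀ n i, MemLp (ε n i) 2 P := fun n i => (hmem n i).mono_exponent (by norm_num)
  -- where the estimates are accurate, the defect of the posterior is exponentially small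
  have hgood : ∀ n, K < n → ∀ ω,
      |sigmaHat (X n) (response (X n) β₀ fun i => ε n i ω) ^ 2 - σ₀ ^ 2| < σ₀ ^ 2 / 2 →
      (∀ j, |(√(n : ℝ))⁻¹ * scoreNoise (X n) (fun i => ε n i ω) j| < η) →
      |(bayes π (likelihood (X n) n μ
        (rescaled (X n) (response (X n) β₀ fun i => ε n i ω)))).real
          {γ | 1 - δ < γ k / (1 + γ k)} - 1| ≤ Real.exp (-c * n) * q := by
    intro n hn ω hs hd
    have hn0 : 0 < n := by omega
    have hXn := transpose_mul_self_of_orthogonal hn0 (hX n hn)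
    set Y := response (X n) β₀ fun i => ε n i ω with hY
    have hσ2 : 0 < σ₀ ^ 2 := by positivity
    obtain ⟨hs1, hs2⟩ := abs_lt.1 hs
    have hs0 : 0 < sigmaHat (X n) Y := by
      refine lt_of_le_of_ne (Real.sqrt_nonneg _) fun h => ?_
      rw [← h] at hs1
      nlinarith
    have hxi : ∀ j, xi (X n) Y j = (sigmaHat (X n) Y)⁻¹ * (√(n : ℝ) *
        (β₀ j + (√(n : ℝ))⁻¹ * scoreNoise (X n) (fun i => ε n i ω) j)) := fun j => by
      have : √(n : ℝ) ≠ 0 := by positivity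
      rw [hY, xi_response hn0 hXn, mul_add (√(n : ℝ)), mul_inv_cancel_left₀ this]
    have hexp := spike_exponent_le (σ₀ := σ₀) (Nat.cast_nonneg n) hs0 (by linarith) hδ hη hk
      (fun j => (hd j).le) hT hTA
    simp only [← hxi] at hexp
    have hbl : bayes π (likelihood (X n) n μ (rescaled (X n) Y)) =
        bayes π (productLikelihood (xi (X n) Y)) :=
      bayes_likelihood hn0 hXn hμ Y π (g := id) measurable_id
    rw [hbl]
    have := isProbabilityMeasure_bayes (lintegral_productLikelihood_ne_zero π (xi (X n) Y))
      (lintegral_productLikelihood_ne_top π (xi (X n) Y))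
    have hSm : MeasurableSet {γ : Fin K → ℝ | 1 - δ < γ k / (1 + γ k)} :=
      measurableSet_lt (by fun_prop) (by fun_prop)
    have hle := bayes_productLikelihood_spike_le π hpos hT hB (xi (X n) Y) k δ
    rw [abs_sub_comm, ← probReal_compl_eq_one_sub hSm, abs_of_nonneg measureReal_nonneg]
    have hle' := ENNReal.toReal_mono (ENNReal.mul_ne_top (ENNReal.inv_ne_top.2 hB)
      ENNReal.ofReal_ne_top) hle
    rw [ENNReal.toReal_mul, ENNReal.toReal_ofReal (by positivity)] at hle'
    refine hle'.trans ?_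
    rw [hq, mul_left_comm]
    gcongr
  have hlim : Tendsto (fun n : ℕ => Real.exp (-c * n) * q) atTop (𝓝 0) := by
    have : Tendsto (fun n : ℕ => Real.exp (-c * n)) atTop (𝓝 0) :=
      Real.tendsto_exp_atBot.comp
        (tendsto_natCast_atTop_atTop.const_mul_atTop_of_neg (neg_lt_zero.2 hc))
    simpa using this.mul_const q
  have hvarc := tendstoInMeasure_iff_norm.1 (tendstoInMeasure_sq_sigmaHat (β₀ := β₀) hX hindep hmem
    hmean hvar hfourth) (σ₀ ^ 2 / 2) (by positivity)
  have hcoef := fun j => tendstoInMeasure_iff_norm.1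
    (tendstoInMeasure_scoreNoise_div_sqrt hX hindep hmem2 hmean hvar j) η hη_pos
  have hbad := hvarc.add (tendsto_finsetSum Finset.univ fun j _ => hcoef j)
  rw [Finset.sum_const_zero, add_zero] at hbad
  rw [tendstoInMeasure_iff_norm]
  intro r hr
  refine tendsto_of_tendsto_of_tendsto_of_le_of_le' tendsto_const_nhds hbad
    (.of_forall fun _ => zero_le) ?_
  filter_upwards [eventually_gt_atTop K, hlim.eventually (gt_mem_nhds hr)] with n hn hnr
  refine le_trans (measure_mono fun ω hω => ?_) ((measure_union_le _ _).trans
    (add_le_add le_rfl (measure_iUnion_fintype_le P _)))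
  by_contra hcon
  simp only [Set.mem_union, Set.mem_iUnion, Set.mem_ofPred_eq, not_or, not_exists, not_le,
    Real.norm_eq_abs, sub_zero] at hcon hω
  exact absurd (hω.trans (hgood n hn ω hcon.1 hcon.2)) (not_le.2 hnr)

end Selection

end

end SpikeSlab

theorem theorem6
    {Ω : Type*} [MeasurableSpace Ω] (P : Measure Ω) [IsProbabilityMeasure P]
    (K : ℕ)
    -- the orthogonal design matrices, with negligible covariates
    (X : (n : ℕ) → Matrix (Fin n) (Fin K) ℝ)
    (hD2 : SpikeSlab.NegligibleCovariates X)
    (hX : SpikeSlab.OrthogonalDesign X)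
    -- the errors
    (ε : (n : ℕ) → Fin n → Ω → ℝ) (σ₀ M : ℝ) (hσ₀ : 0 < σ₀)
    (hε_indep : ∀ n, iIndepFun (ε n) P)
    (hε_memLp : ∀ n i, MemLp (ε n i) 4 P)
    (hε_mean : ∀ n i, ∫ ω, ε n i ω ∂P = 0)
    (hε_var : ∀ n i, ∫ ω, ε n i ω ^ 2 ∂P = σ₀ ^ 2)
    (hε_fourth : ∀ n i, ∫ ω, ε n i ω ^ 4 ∂P ≤ M)
    -- the true coefficients and the responses
    (β₀ : Fin K → ℝ) (Y : (n : ℕ) → Ω → Fin n → ℝ)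
    (hY : ∀ n ω, Y n ω = SpikeSlab.response (X n) β₀ fun i => ε n i ω)
    -- the prior of the variance, and the variance inflation
    (μ : Measure ℝ) [IsProbabilityMeasure μ] (hμ : μ {1} = 1)
    (lam : ℕ → ℝ) (hlam : ∀ n, lam n = n) :
    -- (a) the posterior of the hypervariances of the nonzero coefficients
    (∀ (π : Measure (Fin K → ℝ)) [IsProbabilityMeasure π],
      (∀ k, π {γ | 0 < γ k} = 1) →
      (∃ η₀ : ℝ, 0 ≤ η₀ ∧ (Set.univ.pi fun _ => Set.Ici η₀) ⊆ π.support) →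
      ∀ δ : ℝ, 0 < δ → ∀ k, β₀ k ≠ 0 →
        TendstoInMeasure P
          (fun n ω =>
            (SpikeSlab.bayes π
              (SpikeSlab.likelihood (X n) (lam n) μ (SpikeSlab.rescaled (X n) (Y n ω)))).real
                {γ | 1 - δ < γ k / (1 + γ k)})
          atTop (fun _ => 1)) ∧
    -- (b) under the continuous bimodal prior: the posterior law of `γₖ` given `w` (Bayes' formula
    -- with the conditional prior given `w`) has the stated density, and these laws are the
    -- conditional laws given `w` under the joint posterior of `(w, γ)`
    (∀ v₀ a₁ a₂ : ℝ, 0 < v₀ → 0 < a₁ → 0 < a₂ → ∀ n, K < n → ∀ ω,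
      (∀ (w : unitInterval) (k : Fin K), ∃ c : ℝ, 0 < c ∧
        (SpikeSlab.bayes (SpikeSlab.gammaGivenW K v₀ a₁ a₂ w)
            (SpikeSlab.likelihood (X n) (lam n) μ (SpikeSlab.rescaled (X n) (Y n ω)))).map
            (fun γ => γ k) =
          (volume.restrict (Set.Ioi 0)).withDensity fun u => ENNReal.ofReal
            (c * SpikeSlab.posteriorShape v₀ a₁ a₂ (SpikeSlab.xi (X n) (Y n ω) k) w u)) ∧
      (∀ (A : Set unitInterval) (B : Set (Fin K → ℝ)), MeasurableSet A → MeasurableSet B →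
        SpikeSlab.bayes (SpikeSlab.bimodalPrior K v₀ a₁ a₂)
            (fun p => SpikeSlab.likelihood (X n) (lam n) μ
              (SpikeSlab.rescaled (X n) (Y n ω)) p.2) (A ×ˢ B) =
          ∫⁻ w in A,
            SpikeSlab.bayes (SpikeSlab.gammaGivenW K v₀ a₁ a₂ w)
              (SpikeSlab.likelihood (X n) (lam n) μ (SpikeSlab.rescaled (X n) (Y n ω))) B
            ∂((SpikeSlab.bayes (SpikeSlab.bimodalPrior K v₀ a₁ a₂)
              (fun p => SpikeSlab.likelihood (X n) (lam n) μ
                (SpikeSlab.rescaled (X n) (Y n ω)) p.2)).map Prod.fst))) ∧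
    -- the null limit of `ξ`
    (∀ k, β₀ k = 0 →
      TendstoInDistribution (fun n ω => SpikeSlab.xi (X n) (Y n ω) k) atTop id
        (fun _ => P) (gaussianReal 0 1)) := by
  obtain rfl : Y = fun n ω => SpikeSlab.response (X n) β₀ fun i => ε n i ω :=
    funext fun n => funext fun ω => hY n ω
  obtain rfl : lam = fun n : ℕ => (n : ℝ) := funext hlam
  refine ⟨?_, ?_, fun k hk =>
    SpikeSlab.tendstoInDistribution_xi hσ₀ hD2 hX hε_indep hε_memLp hε_mean hε_var hε_fourth hk⟩
  · rintro π _ hpos ⟨η₀, hη₀, hsupp⟩ δ hδ k hk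
    exact SpikeSlab.tendstoInMeasure_bayes_slab hσ₀ hX hε_indep hε_memLp hε_mean hε_var hε_fourth
      hμ π hpos hη₀ hsupp hδ hk
  · intro v₀ a₁ a₂ hv₀ h₁ h₂ n hn ω
    have hn0 : 0 < n := by omega
    have hXn := SpikeSlab.transpose_mul_self_of_orthogonal hn0 (hX n hn)
    have hγ := SpikeSlab.isProbabilityMeasure_gammaGivenW K v₀ h₁ h₂
    have hv := SpikeSlab.isProbabilityMeasure_hypervarianceLaw v₀ h₁ h₂
    beta_reduce
    set y := SpikeSlab.response (X n) β₀ fun i => ε n i ω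
    have hw : ∀ w, SpikeSlab.bayes (SpikeSlab.gammaGivenW K v₀ a₁ a₂ w)
        (SpikeSlab.likelihood (X n) n μ (SpikeSlab.rescaled (X n) y)) =
        SpikeSlab.bayes (SpikeSlab.gammaGivenW K v₀ a₁ a₂ w)
          (SpikeSlab.productLikelihood (SpikeSlab.xi (X n) y)) := fun w =>
      SpikeSlab.bayes_likelihood hn0 hXn hμ y _ (g := id) measurable_id
    simp only [hw]
    constructor
    · intro w k
      obtain ⟨c, hc, h⟩ := SpikeSlab.exists_bayes_hypervarianceLaw_eq hv₀ h₁ h₂ w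
        (SpikeSlab.xi (X n) y k)
      have hk := SpikeSlab.map_eval_bayes_pi
        (fun _ : Fin K => SpikeSlab.hypervarianceLaw v₀ a₁ a₂ w)
        (fun j => SpikeSlab.measurable_marginalFactor (SpikeSlab.xi (X n) y j))
        (fun j => SpikeSlab.lintegral_ne_zero_of_pos _ (SpikeSlab.measurable_marginalFactor _)
          (SpikeSlab.ofReal_marginalFactor_pos _))
        (fun j => SpikeSlab.lintegral_marginalFactor_ne_top _ _) k
      exact ⟨c, hc, hk.trans h⟩
    · intro A B hA hB
      rw [SpikeSlab.bayes_likelihood hn0 hXn hμ y _ measurable_snd]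
      exact SpikeSlab.bayes_bind_prod _ (SpikeSlab.measurable_gammaGivenW K v₀ h₁ h₂)
        (SpikeSlab.measurable_productLikelihood _)
        (fun w => SpikeSlab.lintegral_productLikelihood_ne_zero _ _)
        (fun w => SpikeSlab.lintegral_productLikelihood_ne_top _ _) hA hB
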